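/- Let $B\subset\mathbb{P}^1(\mathbb{C})$ be a set of six points, and let $D_7$ be the dihedral group of order $14$. Consider the connected branched coverings $f\colon Z\to\mathbb{P}^1(\mathbb{C})$ (that is, $Z$ is a compact connected Hausdorff space, $f$ is continuous, and around each $z\in Z$ the map $f$ has in suitable local topological complex coordinates centred at $z$ and $f(z)$ the form $w\mapsto w^{e}$ with an integer $e\ge 1$, the ramification index at $z$) that have the following properties: $f$ is Galois with group $D_7$, i.e. the group $\mathrm{Aut}(Z/\mathbb{P}^1)$ of homeomorphisms $h$ of $Z$ with $f\circ h=f$ is isomorphic to $D_7$ and the degree of $f$ is $14$; $f$ is unramified outside $f^{-1}(B)$; and above each point of $B$ the branching scheme is $2,2,2,2,2,2,2$, i.e. there are exactly seven points, each with ramification index $2$. Two such coverings $f\colon Z\to\mathbb{P}^1(\mathbb{C})$ and $f'\colon Z'\to\mathbb{P}^1(\mathbb{C})$ are isomorphic if there is a homeomorphism $h\colon Z\to Z'$ with $f'\circ h=f$. Then the set of isomorphism classes of these coverings is in (noncanonical) one-to-one correspondence with $\mathbb{P}^3(\mathbb{F}_7)$. -/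

import Mathlib

open scoped LinearAlgebra.Projectivization

/-- `f` has ramification index `e` at `z` (with `1 ≤ e`): in suitable topological complex charts
centred at `z` and at `f z`, the map `f` is `w ↦ w ^ e`. -/
def HasRamificationIndex {Z W : Type*} [TopologicalSpace Z] [TopologicalSpace W]
    (f : Z → W) (z : Z) (e : ℕ) : Prop :=
  1 ≤ e ∧ ∃ (φ : OpenPartialHomeomorph Z ℂ) (ψ : OpenPartialHomeomorph W ℂ),
    z ∈ φ.source ∧ f z ∈ ψ.source ∧ φ z = 0 ∧ ψ (f z) = 0 ∧
    Set.MapsTo f φ.source ψ.source ∧ ∀ y ∈ φ.source, ψ (f y) = φ y ^ e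

/-- The fibre of `f` over `x` is finite, and the ramification indices at its points, each point
being counted once, form the multiset `m`. -/
def HasBranchingScheme {Z W : Type*} [TopologicalSpace Z] [TopologicalSpace W]
    (f : Z → W) (x : W) (m : Multiset ℕ) : Prop :=
  ∃ (s : Finset Z) (e : Z → ℕ), (s : Set Z) = f ⁻¹' {x} ∧
    (∀ z ∈ s, HasRamificationIndex f z (e z)) ∧ s.val.map e = m

/-- A connected (finite) branched covering of `ℙ¹(ℂ)`, the Riemann sphere `OnePoint ℂ`:
a compact connected Hausdorff space with a continuous map to the sphere that is, locally around
each point, of the form `w ↦ w ^ e` for some `e ≥ 1`. -/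
structure SphereCovering where
  /-- The total space. -/
  Z : Type
  [top : TopologicalSpace Z]
  [t2 : T2Space Z]
  [compact : CompactSpace Z]
  [connected : ConnectedSpace Z]
  /-- The covering map. -/
  f : Z → OnePoint ℂ
  continuous_f : Continuous f
  locally_power : ∀ z : Z, ∃ e : ℕ, HasRamificationIndex f z e

attribute [instance] SphereCovering.top SphereCovering.t2 SphereCovering.compact
  SphereCovering.connected

namespace SphereCovering

/-- The group `Aut (Z / ℙ¹)` of automorphisms of a covering: the self-homeomorphisms of the
total space that commute with the covering map. -/
def deckGroup (C : SphereCovering) : Subgroup (C.Z ≃ₜ C.Z) where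
  carrier := {h | ∀ z, C.f (h z) = C.f z}
  one_mem' := fun _ => rfl
  mul_mem' := by
    intro g h hg hh z
    exact (hg (h z)).trans (hh z)
  inv_mem' := by
    intro g hg z
    have h1 := hg (g.symm z)
    rw [g.apply_symm_apply] at h1
    exact h1.symm

/-- The covering has degree `n`: over each point of the sphere there are exactly `n` points,
counted with ramification indices. -/
def HasDegree (C : SphereCovering) (n : ℕ) : Prop :=
  ∀ x : OnePoint ℂ, ∃ m : Multiset ℕ, HasBranchingScheme C.f x m ∧ m.sum = n

/-- The covering is Galois with group (isomorphic to) `G`: its automorphism group is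
isomorphic to `G` and its degree is the order of `G`. -/
def IsGaloisWithGroup (C : SphereCovering) (G : Type*) [Group G] : Prop :=
  Nonempty (C.deckGroup ≃* G) ∧ C.HasDegree (Nat.card G)

/-- The covering is unramified at all points that do not lie above `B`. -/
def IsUnramifiedOutside (C : SphereCovering) (B : Set (OnePoint ℂ)) : Prop :=
  ∀ z : C.Z, C.f z ∉ B → HasRamificationIndex C.f z 1

/-- Two coverings are isomorphic if there is a homeomorphism of the total spaces over the
sphere. -/
def Isomorphic (C D : SphereCovering) : Prop :=
  ∃ h : C.Z ≃ₜ D.Z, ∀ z, D.f (h z) = C.f z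

theorem isomorphic_equivalence : Equivalence Isomorphic where
  refl C := ⟨Homeomorph.refl _, fun _ => rfl⟩
  symm := by
    rintro C D ⟨h, hh⟩
    refine ⟨h.symm, fun z => ?_⟩
    have h1 := hh (h.symm z)
    rw [h.apply_symm_apply] at h1
    exact h1.symm
  trans := by
    rintro C D E ⟨h, hh⟩ ⟨k, hk⟩
    exact ⟨h.trans k, fun z => (hk (h z)).trans (hh z)⟩

end SphereCovering

/-- The Galois coverings of `ℙ¹(ℂ)` whose group is the dihedral group `D₇` of order 14, branched
only above `B`, with branching scheme `2,2,2,2,2,2,2` above each point of `B`. -/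
def DihedralCovering (B : Finset (OnePoint ℂ)) : Type 1 :=
  {C : SphereCovering // C.IsGaloisWithGroup (DihedralGroup 7) ∧
    C.IsUnramifiedOutside (B : Set (OnePoint ℂ)) ∧
    ∀ b ∈ B, HasBranchingScheme C.f b {2, 2, 2, 2, 2, 2, 2}}

/-- Isomorphism of coverings, as an equivalence relation on the `D₇`-coverings. -/
def dihedralCoveringSetoid (B : Finset (OnePoint ℂ)) : Setoid (DihedralCovering B) where
  r C D := C.1.Isomorphic D.1
  iseqv :=
    ⟨fun C => SphereCovering.isomorphic_equivalence.refl C.1,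
      fun h => SphereCovering.isomorphic_equivalence.symm h,
      fun h k => SphereCovering.isomorphic_equivalence.trans h k⟩

instance fact_prime_seven : Fact (Nat.Prime 7) := ⟨by norm_num⟩

/-! The coverings are classified by cutting the sphere along a circle through the six branch points.
By a homeomorphism the sphere is a double of the closed disc, with the six branch points at six
vertices on the boundary circle, which they divide into six arcs (`DiscDouble`, `arc`, `vertex`).

Over each closed disc minus the vertices, which is convex, a covering that is unramified outside the
vertices has a section. It extends continuously to the vertices, because the fibres there are finite
and the total space is compact (`SphereCovering.exists_section`). On the `k`-th arc the two sections
differ by an automorphism `G k` (`DihedralCovering.exists_cutting`), and the covering is determined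
up to isomorphism by `G`, as its total space consists of the translates of the two closed discs
glued along their boundary arcs according to `G` (`Cutting.isomorphic`). Other choices of the two
sections multiply `G` from the left and from the right by fixed elements and
another identification of the automorphism group with `D₇` applies an automorphism of `D₇`
(`Cutting.nonempty_mul`, `Cutting.nonempty_map`).

The ramification index at a vertex is two, hence `(G k)⁻¹ * G (k + 1)` is a reflection. After a
normalization `G 0 = 1` and `G 3 = sr 0`, so that `G` has the form `gluing v` with `v` in `𝔽₇⁴`; the
choices that remain multiply `v` by a unit (`exists_gluing`, `exists_smul_eq`). If `v` were zero,
then the elements `G k` would not generate `D₇`, and the total space would be disconnected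
(`gluing_ne_zero`). Thus the isomorphism classes inject into the projective space
(`nonempty_equiv_projectivization`).

For surjectivity, a covering is constructed for each `v ≠ 0`. On the round sphere take a function
`P` with simple zeros at the six vertices that is real on the equator (`Sph.radicand`), and extract
first a square root of `P`, then a seventh root of a circle-valued function on the resulting double
covering that is inverted by its involution (`DoubleCover.circleFn`). Over the arcs where `P` is
positive the two explicit sections differ by a rotation, over those where `P` is negative by a
reflection, and the function is chosen so that these elements are `gluing v`
(`DihedralSpace.sec_false_eq`). They generate `D₇`, and hence the space is connected
(`DihedralSpace.connectedSpace`). -/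

open Topology Filter Set
open scoped ComplexConjugate

/-! ### Local behaviour of maps with a ramification index -/

section Ramification

variable {Z W X : Type*} [TopologicalSpace Z] [TopologicalSpace W] [TopologicalSpace X]

/-- A map with ramification index `1` is a local homeomorphism. -/
theorem isLocalHomeomorphOn_of_hasRamificationIndex_one {f : Z → W} {s : Set Z}
    (h : ∀ z ∈ s, HasRamificationIndex f z 1) : IsLocalHomeomorphOn f s := by
  refine IsLocalHomeomorphOn.mk _ _ fun z hz => ?_
  obtain ⟨-, φ, ψ, hzφ, hzψ, hφ0, hψ0, hmaps, hpow⟩ := h z hz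
  have key : ∀ y ∈ φ.source, φ y ∈ ψ.target ∧ f y = ψ.symm (φ y) := fun y hy => by
    have h1 := hpow y hy
    rw [pow_one] at h1
    rw [← h1]
    exact ⟨ψ.map_source (hmaps hy), (ψ.left_inv (hmaps hy)).symm⟩
  refine ⟨φ.trans ψ.symm, ?_, ?_⟩
  · simp only [OpenPartialHomeomorph.trans_source, OpenPartialHomeomorph.symm_source,
      mem_inter_iff, mem_preimage]
    exact ⟨hzφ, (key z hzφ).1⟩
  · intro y hy
    simp only [OpenPartialHomeomorph.trans_source, mem_inter_iff] at hy
    exact (key y hy.1).2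

theorem HasRamificationIndex.exists_injOn {f : Z → W} {z : Z}
    (h : HasRamificationIndex f z 1) : ∃ U ∈ 𝓝 z, InjOn f U := by
  obtain ⟨-, φ, ψ, hzφ, hzψ, hφ0, hψ0, hmaps, hpow⟩ := h
  refine ⟨φ.source, φ.open_source.mem_nhds hzφ, fun a ha b hb hab => φ.injOn ha hb ?_⟩
  have h1 := hpow a ha
  have h2 := hpow b hb
  rw [pow_one] at h1 h2
  rw [← h1, ← h2, hab]

/-- Close to a point of ramification index at least two, points are identified: take two points
whose coordinates differ by a root of unity. -/
theorem HasRamificationIndex.not_injOn {f : Z → W} {z : Z} {e : ℕ} (he : 2 ≤ e)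
    (h : HasRamificationIndex f z e) {U : Set Z} (hU : U ∈ 𝓝 z) : ¬ InjOn f U := by
  obtain ⟨-, φ, ψ, hzφ, hzψ, hφ0, hψ0, hmaps, hpow⟩ := h
  intro hinj
  have h1 : φ.symm ⁻¹' (U ∩ φ.source) ∩ φ.target ∈ 𝓝 (0 : ℂ) := by
    refine inter_mem ?_ (φ.open_target.mem_nhds (hφ0 ▸ φ.map_source hzφ))
    have := φ.symm.continuousAt (x := 0) (by simpa [hφ0] using φ.map_source hzφ)
    refine this.preimage_mem_nhds ?_
    rw [← hφ0, φ.left_inv hzφ]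
    exact inter_mem hU (φ.open_source.mem_nhds hzφ)
  obtain ⟨r, hr, hball⟩ := Metric.mem_nhds_iff.1 h1
  obtain ⟨ζ, hζ⟩ : ∃ ζ : ℂ, IsPrimitiveRoot ζ e := ⟨_, Complex.isPrimitiveRoot_exp e (by omega)⟩
  have hζ1 : ‖ζ‖ = 1 := hζ.norm'_eq_one (by omega)
  have hw : ((r / 2 : ℝ) : ℂ) ∈ Metric.ball (0 : ℂ) r := by
    simp only [mem_ball_zero_iff, Complex.norm_real, Real.norm_eq_abs]
    rw [abs_of_pos (by linarith)]; linarith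
  have hζw : ζ * ((r / 2 : ℝ) : ℂ) ∈ Metric.ball (0 : ℂ) r := by
    simpa only [mem_ball_zero_iff, norm_mul, hζ1, one_mul] using hw
  have a := hball hw
  have b := hball hζw
  have hne : f (φ.symm ((r / 2 : ℝ) : ℂ)) = f (φ.symm (ζ * ((r / 2 : ℝ) : ℂ))) := by
    refine ψ.injOn (hmaps a.1.2) (hmaps b.1.2) ?_
    rw [hpow _ a.1.2, hpow _ b.1.2, φ.right_inv a.2, φ.right_inv b.2, mul_pow, hζ.pow_eq_one,
      one_mul]
  have h2 := φ.symm.injOn (by simpa using a.2) (by simpa using b.2) (hinj a.1.1 b.1.1 hne)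
  have hr0 : ((r / 2 : ℝ) : ℂ) ≠ 0 := by
    norm_cast; linarith
  have : ζ = 1 := by
    have h3 : (1 : ℂ) * ((r / 2 : ℝ) : ℂ) = ζ * ((r / 2 : ℝ) : ℂ) := by rw [one_mul]; exact h2
    exact (mul_right_cancel₀ hr0 h3).symm
  exact hζ.ne_one (by omega) this

theorem HasRamificationIndex.eq_one_of_one {f : Z → W} {z : Z} {e : ℕ}
    (h1 : HasRamificationIndex f z 1) (h : HasRamificationIndex f z e) : e = 1 := by
  obtain ⟨U, hU, hinj⟩ := h1.exists_injOn
  by_contra hne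
  exact h.not_injOn (by have := h.1; omega) hU hinj

theorem HasRamificationIndex.eventually_ne {f : Z → W} {z : Z} {e : ℕ}
    (h : HasRamificationIndex f z e) : ∀ᶠ y in 𝓝[≠] z, f y ≠ f z := by
  obtain ⟨he, φ, ψ, hzφ, hzψ, hφ0, hψ0, hmaps, hpow⟩ := h
  rw [eventually_nhdsWithin_iff]
  filter_upwards [φ.open_source.mem_nhds hzφ] with y hy hyz hf
  have h1 := hpow y hy
  rw [hf, hψ0] at h1
  have h2 : φ y = 0 := pow_eq_zero_iff (by omega) |>.1 h1.symm
  exact hyz (φ.injOn hy hzφ (h2.trans hφ0.symm))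

theorem HasRamificationIndex.neBot {f : Z → W} {z : Z} {e : ℕ}
    (h : HasRamificationIndex f z e) : (𝓝[≠] z).NeBot := by
  obtain ⟨he, φ, ψ, hzφ, hzψ, hφ0, hψ0, hmaps, hpow⟩ := h
  rw [← mem_closure_iff_nhdsWithin_neBot, mem_closure_iff_nhds]
  intro t ht
  have h1 : φ.symm ⁻¹' t ∩ φ.target ∈ 𝓝 (0 : ℂ) := by
    refine inter_mem ?_ (φ.open_target.mem_nhds (hφ0 ▸ φ.map_source hzφ))
    have := φ.symm.continuousAt (x := 0) (by simpa [hφ0] using φ.map_source hzφ)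
    refine this.preimage_mem_nhds ?_
    rwa [← hφ0, φ.left_inv hzφ]
  obtain ⟨w, hw, hw0⟩ := ((inferInstance : (𝓝[≠] (0 : ℂ)).NeBot).nonempty_of_mem
    (inter_mem (mem_nhdsWithin_of_mem_nhds h1) self_mem_nhdsWithin))
  refine ⟨φ.symm w, hw.1, fun h => hw0 ?_⟩
  rw [mem_singleton_iff] at h ⊢
  rw [← φ.right_inv hw.2, h, hφ0]

theorem isConnected_punctured_ball {r : ℝ} (hr : 0 < r) :
    IsConnected (Metric.ball (0 : ℂ) r \ {0}) := by
  have : Metric.ball (0 : ℂ) r \ {0} =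
      (fun p : ℝ × ℝ => (p.1 : ℂ) * Complex.exp (p.2 * Complex.I)) '' (Ioo 0 r ×ˢ univ) := by
    ext w
    simp only [Set.mem_sdiff, mem_ball_zero_iff, mem_singleton_iff, mem_image, mem_prod, mem_Ioo,
      mem_univ, and_true, Prod.exists]
    constructor
    · rintro ⟨h1, h2⟩
      exact ⟨‖w‖, w.arg, ⟨norm_pos_iff.2 h2, h1⟩, Complex.norm_mul_exp_arg_mul_I w⟩
    · rintro ⟨a, b, ⟨ha, hb⟩, rfl⟩
      simp only [norm_mul, Complex.norm_real, Complex.norm_exp_ofReal_mul_I, mul_one,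
        Real.norm_eq_abs, abs_of_pos ha, mul_eq_zero, Complex.exp_ne_zero, or_false]
      exact ⟨hb, by exact_mod_cast ha.ne'⟩
  rw [this]
  refine ((isConnected_Ioo hr).prod isConnected_univ).image _ ?_
  fun_prop

/-- Around a point with a ramification index there are arbitrarily small neighbourhoods that stay
connected when the point is removed. -/
theorem HasRamificationIndex.exists_punctured_connected {f : Z → W} {z : Z} {e : ℕ}
    (h : HasRamificationIndex f z e) {U : Set Z} (hU : U ∈ 𝓝 z) :
    ∃ V ∈ 𝓝 z, V ⊆ U ∧ IsPreconnected (V \ {z}) := by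
  obtain ⟨he, φ, ψ, hzφ, hzψ, hφ0, hψ0, hmaps, hpow⟩ := h
  have h1 : φ.symm ⁻¹' U ∩ φ.target ∈ 𝓝 (0 : ℂ) := by
    refine inter_mem ?_ (φ.open_target.mem_nhds (hφ0 ▸ φ.map_source hzφ))
    have := φ.symm.continuousAt (x := 0) (by simpa [hφ0] using φ.map_source hzφ)
    refine this.preimage_mem_nhds ?_
    rwa [← hφ0, φ.left_inv hzφ]
  obtain ⟨r, hr, hball⟩ := Metric.mem_nhds_iff.1 h1
  have hz : φ.symm 0 = z := by rw [← hφ0, φ.left_inv hzφ]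
  refine ⟨φ.symm '' Metric.ball 0 r, ?_, ?_, ?_⟩
  · refine (φ.symm.isOpen_image_of_subset_source Metric.isOpen_ball
      fun w hw => by simpa using (hball hw).2).mem_nhds ⟨0, by simpa using hr, hz⟩
  · rintro _ ⟨w, hw, rfl⟩
    exact (hball hw).1
  · have : φ.symm '' Metric.ball 0 r \ {z} = φ.symm '' (Metric.ball 0 r \ {0}) := by
      ext y
      constructor
      · rintro ⟨⟨w, hw, rfl⟩, hy⟩
        exact ⟨w, ⟨hw, fun h => hy (by rw [mem_singleton_iff] at h; rw [h]; exact hz)⟩, rfl⟩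
      · rintro ⟨w, ⟨hw, hw0⟩, rfl⟩
        refine ⟨⟨w, hw, rfl⟩, fun h => hw0 ?_⟩
        rw [mem_singleton_iff] at h ⊢
        rw [← φ.right_inv (hball hw).2, h, hφ0]
    rw [this]
    exact (isConnected_punctured_ball hr).isPreconnected.image _
      (φ.symm.continuousOn.mono fun w hw => by simpa using (hball hw.1).2)

/-- Near a point of ramification index two, no compact set can meet every nearby fibre in exactly
one point. In the coordinate `w` for which `f` is `w ↦ w ^ 2` such a set would be a closed set `E`
of a disc with `E ∪ -E` everything and `E ∩ -E = {0}`, contradicting the connectedness of the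
punctured disc. -/
theorem HasRamificationIndex.not_injOn_of_isCompact [T2Space Z] [T2Space W] {f : Z → W}
    (hf : Continuous f) {z : Z} (h : HasRamificationIndex f z 2) {T : Set Z} (hT : IsCompact T)
    (hzT : z ∈ T) (hnhds : f '' T ∈ 𝓝 (f z)) : ¬ InjOn f T := by
  intro hinj
  obtain ⟨-, φ, ψ, hzφ, hzψ, hφ0, hψ0, hmaps, hpow⟩ := h
  have h0t : (0 : ℂ) ∈ φ.target := hφ0 ▸ φ.map_source hzφ
  have hz0 : φ.symm 0 = z := by rw [← hφ0, φ.left_inv hzφ]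
  have hcl : IsClosed (f '' (T \ φ.source)) :=
    ((hT.diff φ.open_source).image hf).isClosed
  have hnot : f z ∉ f '' (T \ φ.source) := by
    rintro ⟨y, ⟨hyT, hy⟩, hyz⟩
    exact hy (hinj hyT hzT hyz ▸ hzφ)
  have hN : f '' T ∩ (f '' (T \ φ.source))ᶜ ∈ 𝓝 (f z) :=
    inter_mem hnhds (hcl.isOpen_compl.mem_nhds hnot)
  have h1 : (φ.symm ⁻¹' (f ⁻¹' (f '' T ∩ (f '' (T \ φ.source))ᶜ))) ∩ φ.target ∈ 𝓝 (0 : ℂ) := by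
    refine inter_mem ?_ (φ.open_target.mem_nhds h0t)
    have := φ.symm.continuousAt (x := 0) (by simpa using h0t)
    refine this.preimage_mem_nhds (hf.continuousAt.preimage_mem_nhds ?_)
    rwa [hz0]
  obtain ⟨r, hr, hball⟩ := Metric.mem_nhds_iff.1 h1
  -- in coordinates, `T` contains exactly one of `w` and `-w`
  have hor : ∀ w ∈ Metric.ball (0 : ℂ) r, φ.symm w ∈ T ∨ φ.symm (-w) ∈ T := by
    intro w hw
    obtain ⟨⟨⟨y, hyT, hy⟩, hy2⟩, hwt⟩ := hball hw
    have hys : y ∈ φ.source := by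
      by_contra hys
      exact hy2 ⟨y, ⟨hyT, hys⟩, hy⟩
    have h2 : φ y ^ 2 = w ^ 2 := by
      rw [← hpow y hys, hy, hpow _ (φ.map_target hwt), φ.right_inv hwt]
    rcases sq_eq_sq_iff_eq_or_eq_neg.1 h2 with h3 | h3
    · left; rw [← h3, φ.left_inv hys]; exact hyT
    · right; rw [← h3, φ.left_inv hys]; exact hyT
  have hneg : ∀ w ∈ Metric.ball (0 : ℂ) r, -w ∈ Metric.ball (0 : ℂ) r := fun w hw => by
    simpa using hw
  have hand : ∀ w ∈ Metric.ball (0 : ℂ) r, φ.symm w ∈ T → φ.symm (-w) ∈ T → w = 0 := by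
    intro w hw h3 h4
    have ha := (hball hw).2
    have hb := (hball (hneg w hw)).2
    have h5 : f (φ.symm w) = f (φ.symm (-w)) := by
      refine ψ.injOn (hmaps (φ.map_target ha)) (hmaps (φ.map_target hb)) ?_
      rw [hpow _ (φ.map_target ha), hpow _ (φ.map_target hb), φ.right_inv ha, φ.right_inv hb,
        neg_sq]
    have h6 := φ.symm.injOn (by simpa using ha) (by simpa using hb) (hinj h3 h4 h5)
    exact self_eq_neg.1 h6
  have hTc := hT.isClosed
  set Q := Metric.ball (0 : ℂ) r \ {0} with hQ
  have hconn : IsConnected Q := isConnected_punctured_ball hr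
  have c1 : ContinuousOn φ.symm Q := φ.symm.continuousOn.mono fun w hw => by
    simpa using (hball hw.1).2
  have c2 : ContinuousOn (fun w => φ.symm (-w)) Q := by
    refine φ.symm.continuousOn.comp continuous_neg.continuousOn fun w hw => ?_
    simpa using (hball (hneg w hw.1)).2
  obtain ⟨t1, ht1, e1⟩ := continuousOn_iff_isClosed.1 c1 T hTc
  obtain ⟨t2, ht2, e2⟩ := continuousOn_iff_isClosed.1 c2 T hTc
  have m1 : ∀ w ∈ Q, (w ∈ t1 ↔ φ.symm w ∈ T) := fun w hw => by
    have := Set.ext_iff.1 e1 w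
    simp only [mem_inter_iff, mem_preimage, hw, and_true] at this
    exact this.symm
  have m2 : ∀ w ∈ Q, (w ∈ t2 ↔ φ.symm (-w) ∈ T) := fun w hw => by
    have := Set.ext_iff.1 e2 w
    simp only [mem_inter_iff, mem_preimage, hw, and_true] at this
    exact this.symm
  have hnegQ : ∀ w ∈ Q, -w ∈ Q := fun w hw => ⟨hneg w hw.1, by simpa using hw.2⟩
  obtain ⟨w0, hw0⟩ := hconn.nonempty
  have key := isPreconnected_closed_iff.1 hconn.isPreconnected t1 t2 ht1 ht2 (fun w hw => by
    rcases hor w hw.1 with h3 | h3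
    · exact Or.inl ((m1 w hw).2 h3)
    · exact Or.inr ((m2 w hw).2 h3))
  have n1 : (Q ∩ t1).Nonempty := by
    rcases hor w0 hw0.1 with h3 | h3
    · exact ⟨w0, hw0, (m1 w0 hw0).2 h3⟩
    · exact ⟨-w0, hnegQ w0 hw0, (m1 _ (hnegQ w0 hw0)).2 h3⟩
  have n2 : (Q ∩ t2).Nonempty := by
    obtain ⟨w, hw, hwt⟩ := n1
    refine ⟨-w, hnegQ w hw, (m2 _ (hnegQ w hw)).2 ?_⟩
    rw [neg_neg]
    exact (m1 w hw).1 hwt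
  obtain ⟨w, hw, hwt1, hwt2⟩ := key n1 n2
  exact hw.2 (hand w hw.1 ((m1 w hw).1 hwt1) ((m2 w hw).1 hwt2))

/-- Composing with a homeomorphism of the base does not change ramification. -/
theorem HasRamificationIndex.homeomorph_comp {f : Z → W} {z : Z} {e : ℕ}
    (h : HasRamificationIndex f z e) (H : W ≃ₜ X) :
    HasRamificationIndex (fun y => H (f y)) z e := by
  obtain ⟨he, φ, ψ, hzφ, hzψ, hφ0, hψ0, hmaps, hpow⟩ := h
  refine ⟨he, φ, H.symm.toOpenPartialHomeomorph.trans ψ, hzφ, ?_, hφ0, ?_, ?_, ?_⟩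
  · simpa using hzψ
  · simpa using hψ0
  · intro y hy
    simpa using hmaps hy
  · intro y hy
    simpa using hpow y hy

end Ramification

/-- Two lifts of the same map on a preconnected set agree if they agree at one point, provided that
they stay in the set where `f` is locally injective. -/
theorem eqOn_of_lifts {Z X Y : Type*} [TopologicalSpace Z] [TopologicalSpace X] [T2Space Z]
    {f : Z → Y} {U : Set Z}
    (hU : ∀ z ∈ U, ∃ V ∈ 𝓝 z, InjOn f V) {A : Set X} (hA : IsPreconnected A) {g g' : X → Z}
    (hg : ContinuousOn g A) (hg' : ContinuousOn g' A) (hgU : MapsTo g A U)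
    (hfg : ∀ a ∈ A, f (g a) = f (g' a)) {a : X} (haA : a ∈ A) (ha : g a = g' a) : EqOn g g' A := by
  have : PreconnectedSpace A := isPreconnected_iff_preconnectedSpace.1 hA
  rw [continuousOn_iff_continuous_domRestrict] at hg hg'
  have hclopen : IsClopen {x : A | A.domRestrict g x = A.domRestrict g' x} := by
    refine ⟨isClosed_eq hg hg', isOpen_iff_mem_nhds.2 fun x hx => ?_⟩
    obtain ⟨V, hV, hinj⟩ := hU _ (hgU x.2)
    filter_upwards [hg.continuousAt.preimage_mem_nhds (t := V) hV,
      hg'.continuousAt.preimage_mem_nhds (t := V) (hx ▸ hV)] with y h1 h2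
    exact hinj h1 h2 (hfg _ y.2)
  have huniv := hclopen.eq_univ ⟨⟨a, haA⟩, ha⟩
  intro x hx
  exact (huniv.ge (mem_univ (⟨x, hx⟩ : A)) :)

/-! ### Six arcs on the unit circle -/

/-- The closed unit disc of the complex plane. -/
abbrev Disc : Type := Metric.closedBall (0 : ℂ) 1

/-- The six closed arcs, in cyclic order, into which the lines `re = 0` and `re = ± 1/2` cut the
unit circle; the arcs `0` and `3` are the rightmost and the leftmost one. -/
def arc : Fin 6 → Set ℂ :=
  ![{w | ‖w‖ = 1 ∧ 1 / 2 ≤ w.re},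
    {w | ‖w‖ = 1 ∧ (0 ≤ w.re ∧ w.re ≤ 1 / 2) ∧ 0 ≤ w.im},
    {w | ‖w‖ = 1 ∧ (-(1 / 2) ≤ w.re ∧ w.re ≤ 0) ∧ 0 ≤ w.im},
    {w | ‖w‖ = 1 ∧ w.re ≤ -(1 / 2)},
    {w | ‖w‖ = 1 ∧ (-(1 / 2) ≤ w.re ∧ w.re ≤ 0) ∧ w.im ≤ 0},
    {w | ‖w‖ = 1 ∧ (0 ≤ w.re ∧ w.re ≤ 1 / 2) ∧ w.im ≤ 0}]

/-- The six end points of the arcs: `vertex k` is the common end point of the arcs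
`k` and `k + 1`. -/
noncomputable def vertex : Fin 6 → ℂ :=
  ![⟨1 / 2, √3 / 2⟩, ⟨0, 1⟩, ⟨-(1 / 2), √3 / 2⟩, ⟨-(1 / 2), -(√3 / 2)⟩, ⟨0, -1⟩, ⟨1 / 2, -(√3 / 2)⟩]

theorem norm_eq_one_iff_sq {w : ℂ} : ‖w‖ = 1 ↔ w.re ^ 2 + w.im ^ 2 = 1 := by
  rw [← sq_eq_sq₀ (norm_nonneg _) zero_le_one, Complex.sq_norm, Complex.normSq_apply, one_pow]
  constructor <;> intro h <;> nlinarith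

theorem sqrt_three_half_sq : (√3 / 2 : ℝ) ^ 2 = 3 / 4 := by
  rw [div_pow, Real.sq_sqrt (by norm_num)]; norm_num

theorem sqrt_three_half_bounds : (1 / 2 : ℝ) < √3 / 2 ∧ √3 / 2 < (1 : ℝ) := by
  have h := sqrt_three_half_sq
  have h0 : (0 : ℝ) ≤ √3 / 2 := by positivity
  constructor <;> nlinarith

theorem norm_vertex (k : Fin 6) : ‖vertex k‖ = 1 := by
  rw [norm_eq_one_iff_sq]
  have h := sqrt_three_half_sq
  fin_cases k <;> simp only [vertex] <;> norm_num [h]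

theorem vertex_injective : Function.Injective vertex := by
  have h := sqrt_three_half_bounds
  intro i j hij
  have h1 := congrArg Complex.re hij
  have h2 := congrArg Complex.im hij
  fin_cases i <;> fin_cases j <;> simp [vertex] at h1 h2 ⊢ <;> exfalso <;> linarith

theorem norm_eq_one_of_mem_arc {k : Fin 6} {w : ℂ} (h : w ∈ arc k) : ‖w‖ = 1 := by
  fin_cases k <;> exact h.1

theorem isClosed_arc (k : Fin 6) : IsClosed (arc k) := by
  have e (p : ℂ → Prop) (hp : IsClosed {w | p w}) : IsClosed {w : ℂ | ‖w‖ = 1 ∧ p w} :=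
    (isClosed_eq continuous_norm continuous_const).inter hp
  have re := Complex.continuous_re
  have im := Complex.continuous_im
  have c {f g : ℂ → ℝ} (hf : Continuous f) (hg : Continuous g) : IsClosed {w | f w ≤ g w} :=
    isClosed_le hf hg
  fin_cases k
  · exact e _ (c continuous_const re)
  · exact e _ (((c continuous_const re).inter (c re continuous_const)).inter
      (c continuous_const im))
  · exact e _ (((c continuous_const re).inter (c re continuous_const)).inter
      (c continuous_const im))
  · exact e _ (c re continuous_const)
  · exact e _ (((c continuous_const re).inter (c re continuous_const)).inter
      (c im continuous_const))
  · exact e _ (((c continuous_const re).inter (c re continuous_const)).inter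
      (c im continuous_const))

theorem exists_mem_arc {w : ℂ} (hw : ‖w‖ = 1) : ∃ k, w ∈ arc k := by
  rcases le_total (1 / 2) w.re with h | h
  · exact ⟨0, hw, h⟩
  rcases le_total w.re (-(1 / 2)) with h' | h'
  · exact ⟨3, hw, h'⟩
  rcases le_total 0 w.re with h1 | h1 <;> rcases le_total 0 w.im with h2 | h2
  · exact ⟨1, hw, ⟨h1, h⟩, h2⟩
  · exact ⟨5, hw, ⟨h1, h⟩, h2⟩
  · exact ⟨2, hw, ⟨h', h1⟩, h2⟩
  · exact ⟨4, hw, ⟨h', h1⟩, h2⟩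

theorem vertex_mem_arc_iff (k j : Fin 6) : vertex k ∈ arc j ↔ j = k ∨ j = k + 1 := by
  have h := sqrt_three_half_bounds
  have hn := norm_vertex k
  have hs : ¬ (√3 / 2 ≤ (0 : ℝ)) := by linarith
  have hs' : (0 : ℝ) ≤ √3 / 2 := by linarith
  fin_cases k <;> fin_cases j <;> simp [arc, vertex] at hn ⊢ <;>
    first | (exact ⟨hn, hs'⟩) | (norm_num [hn]; done) | (norm_num [hn]; linarith)

theorem vertex_re (k : Fin 6) :
    (vertex k).re = 1 / 2 ∨ (vertex k).re = 0 ∨ (vertex k).re = -(1 / 2) := by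
  fin_cases k <;> simp [vertex]

/-- Each arc is the closure of a connected set that contains none of the six vertices. -/
theorem exists_arc_interior (k : Fin 6) : ∃ A ⊆ arc k, IsPreconnected A ∧ A.Nonempty ∧
    Disjoint A (range vertex) ∧ arc k ⊆ closure A := by
  obtain ⟨γ, a, b, hab, hγ, himg, hv⟩ : ∃ (γ : ℝ → ℂ) (a b : ℝ), a < b ∧ Continuous γ ∧
      γ '' Icc a b = arc k ∧ ∀ t ∈ Ioo a b, γ t ∉ range vertex := by
    have h3 := sqrt_three_half_sq
    obtain ⟨h4, h5⟩ := sqrt_three_half_bounds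
    -- the arcs in the half-planes `0 ≤ s * im`, parametrised by the real part
    have hre : ∀ (s : ℝ) (a b : ℝ), s ^ 2 = 1 → -1 ≤ a → b ≤ 1 →
        (fun x : ℝ => (⟨x, s * √(1 - x ^ 2)⟩ : ℂ)) '' Icc a b =
          {w | ‖w‖ = 1 ∧ (a ≤ w.re ∧ w.re ≤ b) ∧ 0 ≤ s * w.im} := by
      intro s a b hs ha hb
      ext w
      constructor
      · rintro ⟨x, ⟨hx1, hx2⟩, rfl⟩
        have h0 : (0 : ℝ) ≤ 1 - x ^ 2 := by nlinarith
        refine ⟨norm_eq_one_iff_sq.2 ?_, ⟨hx1, hx2⟩, ?_⟩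
        · simp only [mul_pow, Real.sq_sqrt h0, hs]; ring
        · simp only [← mul_assoc, ← sq, hs, one_mul]; positivity
      · rintro ⟨h1, ⟨h2, h2'⟩, h3⟩
        refine ⟨w.re, ⟨h2, h2'⟩, Complex.ext rfl ?_⟩
        rw [norm_eq_one_iff_sq] at h1
        have : 1 - w.re ^ 2 = (s * w.im) ^ 2 := by rw [mul_pow, hs]; linarith
        simp only [this, Real.sqrt_sq h3]
        rw [← mul_assoc, ← sq, hs, one_mul]
    -- the rightmost and the leftmost arc, parametrised by the imaginary part
    have him : ∀ (s : ℝ), s ^ 2 = 1 →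
        (fun y : ℝ => (⟨s * √(1 - y ^ 2), y⟩ : ℂ)) '' Icc (-(√3 / 2)) (√3 / 2) =
          {w | ‖w‖ = 1 ∧ 1 / 2 ≤ s * w.re} := by
      intro s hs
      ext w
      constructor
      · rintro ⟨y, ⟨hy1, hy2⟩, rfl⟩
        have h0 : (1 / 2 : ℝ) ^ 2 ≤ 1 - y ^ 2 := by nlinarith
        refine ⟨norm_eq_one_iff_sq.2 ?_, ?_⟩
        · simp only [mul_pow, Real.sq_sqrt (show (0 : ℝ) ≤ 1 - y ^ 2 by nlinarith), hs]; ring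
        · simp only [← mul_assoc, ← sq, hs, one_mul]
          exact Real.le_sqrt_of_sq_le h0
      · rintro ⟨h1, h2⟩
        rw [norm_eq_one_iff_sq] at h1
        have e : 1 - w.im ^ 2 = (s * w.re) ^ 2 := by rw [mul_pow, hs]; linarith
        have h6 : w.im ^ 2 ≤ (√3 / 2) ^ 2 := by nlinarith
        refine ⟨w.im, abs_le.1 (abs_le_of_sq_le_sq h6 (by linarith)), Complex.ext ?_ rfl⟩
        simp only [e, Real.sqrt_sq (show 0 ≤ s * w.re by linarith)]
        rw [← mul_assoc, ← sq, hs, one_mul]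
    have cre : ∀ s : ℝ, Continuous (fun x : ℝ => (⟨x, s * √(1 - x ^ 2)⟩ : ℂ)) := fun s =>
      Complex.equivRealProdCLM.symm.continuous.comp
        (continuous_id.prodMk (by fun_prop : Continuous fun x : ℝ => s * √(1 - x ^ 2)))
    have cim : ∀ s : ℝ, Continuous (fun y : ℝ => (⟨s * √(1 - y ^ 2), y⟩ : ℂ)) := fun s =>
      Complex.equivRealProdCLM.symm.continuous.comp
        ((by fun_prop : Continuous fun x : ℝ => s * √(1 - x ^ 2)).prodMk continuous_id)
    have vre : ∀ (s a b x : ℝ), (a = 0 ∧ b = 1 / 2 ∨ a = -(1 / 2) ∧ b = 0) → x ∈ Ioo a b →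
        (⟨x, s * √(1 - x ^ 2)⟩ : ℂ) ∉ range vertex := by
      rintro s a b x hab ⟨hx1, hx2⟩ ⟨j, hj⟩
      have h6 := congrArg Complex.re hj
      simp only at h6
      rcases hab with ⟨rfl, rfl⟩ | ⟨rfl, rfl⟩ <;>
        rcases vertex_re j with h7 | h7 | h7 <;> linarith
    have vim : ∀ (s y : ℝ), s ^ 2 = 1 → y ∈ Ioo (-(√3 / 2)) (√3 / 2) →
        (⟨s * √(1 - y ^ 2), y⟩ : ℂ) ∉ range vertex := by
      rintro s y hs ⟨hy1, hy2⟩ ⟨j, hj⟩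
      have h6 := congrArg (fun w => w.re ^ 2) hj
      have h0 : (0 : ℝ) ≤ 1 - y ^ 2 := by nlinarith
      simp only [mul_pow, Real.sq_sqrt h0, hs] at h6
      rcases vertex_re j with h7 | h7 | h7 <;> rw [h7] at h6 <;> nlinarith
    fin_cases k
    · refine ⟨_, _, _, by linarith, cim 1, (him 1 (by norm_num)).trans ?_,
        fun t ht => vim 1 t (by norm_num) ht⟩
      simp [arc]
    · refine ⟨_, 0, 1 / 2, by norm_num, cre 1, (hre 1 _ _ (by norm_num) (by norm_num)
        (by norm_num)).trans ?_, fun t ht => vre 1 _ _ t (Or.inl ⟨rfl, rfl⟩) ht⟩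
      simp [arc]
    · refine ⟨_, -(1 / 2), 0, by norm_num, cre 1, (hre 1 _ _ (by norm_num) (by norm_num)
        (by norm_num)).trans ?_, fun t ht => vre 1 _ _ t (Or.inr ⟨rfl, rfl⟩) ht⟩
      simp [arc]
    · refine ⟨_, _, _, by linarith, cim (-1), (him (-1) (by norm_num)).trans ?_,
        fun t ht => vim (-1) t (by norm_num) ht⟩
      ext w
      simp only [arc, mem_ofPred_eq]
      exact and_congr_right fun _ => ⟨fun h => show w.re ≤ -(1 / 2) by linarith,
        fun h => by have : w.re ≤ -(1 / 2) := h; linarith⟩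
    · refine ⟨_, -(1 / 2), 0, by norm_num, cre (-1), (hre (-1) _ _ (by norm_num) (by norm_num)
        (by norm_num)).trans ?_, fun t ht => vre (-1) _ _ t (Or.inr ⟨rfl, rfl⟩) ht⟩
      simp [arc]
    · refine ⟨_, 0, 1 / 2, by norm_num, cre (-1), (hre (-1) _ _ (by norm_num) (by norm_num)
        (by norm_num)).trans ?_, fun t ht => vre (-1) _ _ t (Or.inl ⟨rfl, rfl⟩) ht⟩
      simp [arc]
  refine ⟨γ '' Ioo a b, himg ▸ image_mono Ioo_subset_Icc_self, isPreconnected_Ioo.image _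
    hγ.continuousOn, (nonempty_Ioo.2 hab).image _, ?_, ?_⟩
  · rw [Set.disjoint_left]
    rintro _ ⟨t, ht, rfl⟩
    exact hv t ht
  · rw [← himg, ← closure_Ioo hab.ne]
    exact image_closure_subset_closure_image hγ

/-- Close to a vertex the unit circle consists of the two adjacent arcs. -/
theorem exists_ball_subset_arc (k : Fin 6) : ∃ ε > 0, ∀ w ∈ Metric.closedBall (vertex k) ε,
    ‖w‖ = 1 → w ∈ arc k ∨ w ∈ arc (k + 1) := by
  have h : (⋃ j ∈ {j : Fin 6 | j ≠ k ∧ j ≠ k + 1}, arc j)ᶜ ∈ 𝓝 (vertex k) := by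
    refine ((toFinite _).isClosed_biUnion fun j _ => isClosed_arc j).isOpen_compl.mem_nhds ?_
    simp only [mem_compl_iff, mem_iUnion, not_exists]
    rintro j ⟨h1, h2⟩ hj
    rcases (vertex_mem_arc_iff k j).1 hj with h | h
    exacts [h1 h, h2 h]
  obtain ⟨ε, hε, hsub⟩ := Metric.nhds_basis_closedBall.mem_iff.1 h
  refine ⟨ε, hε, fun w hw h1 => ?_⟩
  obtain ⟨j, hj⟩ := exists_mem_arc h1
  by_contra hcon
  push Not at hcon
  refine hsub hw (mem_biUnion (x := j) ⟨?_, ?_⟩ hj)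
  · rintro rfl; exact hcon.1 hj
  · rintro rfl; exact hcon.2 hj

/-- A convex subset of the disc stays convex when vertices are removed, since these are extreme
points of the disc. -/
theorem convex_diff_vertex {K : Set ℂ} (hK : Convex ℝ K) (hKD : K ⊆ Metric.closedBall 0 1)
    {s : Set ℂ} (hs : s ⊆ range vertex) : Convex ℝ (K \ s) := by
  rw [convex_iff_pairwise_pos]
  rintro x ⟨hx, hxs⟩ y ⟨hy, hys⟩ hxy a b ha hb hab
  refine ⟨hK hx hy ha.le hb.le hab, fun hmem => ?_⟩
  have h1 := strictConvex_closedBall ℝ (0 : ℂ) 1 (hKD hx) (hKD hy) hxy ha hb hab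
  rw [interior_closedBall _ one_ne_zero, mem_ball_zero_iff] at h1
  obtain ⟨k, hk⟩ := hs hmem
  rw [← hk, norm_vertex] at h1
  exact lt_irrefl _ h1

/-! ### Coverings unramified outside a finite set -/

/-- A map into a compact Hausdorff space has a limit along a filter with a basis of connected sets,
as soon as its composition with `f` tends to a point over which `f` has a finite fibre: it cannot
jump between the disjoint neighbourhoods of the points of the fibre. -/
theorem exists_tendsto_of_finite_fiber {Z W X : Type*} [TopologicalSpace Z] [TopologicalSpace W]
    [CompactSpace Z] [T2Space Z] [T2Space W] {f : Z → W} (hf : Continuous f) {b : W}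
    (hfin : (f ⁻¹' {b}).Finite) {σ : X → Z} {l : Filter X} [l.NeBot]
    (hlim : Tendsto (f ∘ σ) l (𝓝 b))
    (hconn : ∀ s ∈ l, ∃ t ∈ l, t ⊆ s ∧ IsPreconnected (σ '' t)) : ∃ z, Tendsto σ l (𝓝 z) := by
  obtain ⟨z, -, hz⟩ := isCompact_univ (X := Z) (f := map σ l) (by simp)
  refine ⟨z, fun U hU => ?_⟩
  obtain ⟨U1, U2, hU1, hU2, hzU1, hFU2, hdisj⟩ :=
    SeparatedNhds.of_isCompact_isCompact (isCompact_singleton (x := z))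
      ((hfin.subset sdiff_subset : (f ⁻¹' {b} \ {z}).Finite).isCompact)
      (disjoint_singleton_left.2 fun h => h.2 rfl)
  obtain ⟨U', hU'U, hU', hzU'⟩ := mem_nhds_iff.1 hU
  have hcl : IsClosed (f '' ((U1 ∩ U') ∪ U2)ᶜ) :=
    (((hU1.inter hU').union hU2).isClosed_compl.isCompact.image hf).isClosed
  have hb : b ∉ f '' ((U1 ∩ U') ∪ U2)ᶜ := by
    rintro ⟨y, hy, hyb⟩
    refine hy ?_
    by_cases hyz : y = z
    · exact Or.inl (hyz ▸ ⟨hzU1 rfl, hzU'⟩)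
    · exact Or.inr (hFU2 ⟨hyb, hyz⟩)
  have hev : σ ⁻¹' ((U1 ∩ U') ∪ U2) ∈ l := by
    filter_upwards [hlim (hcl.isOpen_compl.mem_nhds hb)] with x hx
    by_contra hcon
    exact hx ⟨σ x, hcon, rfl⟩
  obtain ⟨t, ht, hts, htc⟩ := hconn _ hev
  have hne : (σ '' t ∩ (U1 ∩ U')).Nonempty := by
    rw [inter_comm]
    exact clusterPt_iff_nonempty.1 hz ((hU1.inter hU').mem_nhds ⟨hzU1 rfl, hzU'⟩)
      (image_mem_map ht)
  have hsub := htc.subset_left_of_subset_union (hU1.inter hU') hU2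
    (hdisj.mono_left inter_subset_left) (image_subset_iff.2 hts) hne
  have hsub' : t ⊆ σ ⁻¹' U := fun x hx => hU'U (hsub ⟨x, hx, rfl⟩).2
  exact mem_map.2 (mem_of_superset ht hsub')

namespace SphereCovering

variable {B : Finset (OnePoint ℂ)} {C : SphereCovering}

theorem IsUnramifiedOutside.exists_injOn (hU : C.IsUnramifiedOutside (B : Set (OnePoint ℂ))) :
    ∀ z ∈ C.f ⁻¹' (B : Set (OnePoint ℂ))ᶜ, ∃ V ∈ 𝓝 z, InjOn C.f V :=
  fun z hz => (hU z hz).exists_injOn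

theorem eventually_notMem (z : C.Z) (B : Finset (OnePoint ℂ)) :
    ∀ᶠ y in 𝓝[≠] z, C.f y ∉ B := by
  classical
  obtain ⟨e, he⟩ := C.locally_power z
  have h1 : ((B.erase (C.f z) : Finset (OnePoint ℂ)) : Set (OnePoint ℂ))ᶜ ∈ 𝓝 (C.f z) :=
    (Finset.finite_toSet _).isClosed.isOpen_compl.mem_nhds (by simp)
  filter_upwards [he.eventually_ne,
    mem_nhdsWithin_of_mem_nhds (C.continuous_f.continuousAt.preimage_mem_nhds h1)] with y h2 h3 h4
  exact h3 (by simpa using ⟨h4, h2⟩)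

/-- An automorphism of a covering with an unramified fixed point is the identity. -/
theorem deck_eq_one (hU : C.IsUnramifiedOutside (B : Set (OnePoint ℂ))) {h : C.Z ≃ₜ C.Z}
    (hh : h ∈ C.deckGroup) {z : C.Z} (hz : C.f z ∉ B) (hfix : h z = z) : h = 1 := by
  set E : Set C.Z := {y | h y = y} with hE
  have hEc : IsClosed E := isClosed_eq h.continuous continuous_id
  have hloc : ∀ y ∈ E, C.f y ∉ B → y ∈ interior E := by
    intro y hy hyB
    obtain ⟨V, hV, hinj⟩ := hU.exists_injOn y hyB
    rw [mem_interior_iff_mem_nhds]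
    filter_upwards [hV, h.continuous.continuousAt.preimage_mem_nhds
      (show V ∈ 𝓝 (h y) from (show h y = y from hy).symm ▸ hV)] with x h1 h2
    exact hinj h2 h1 (hh x)
  have hclopen : IsClopen (interior E) := by
    refine ⟨isClosed_of_closure_subset fun y hy => ?_, isOpen_interior⟩
    have hyE : y ∈ E := closure_minimal interior_subset hEc hy
    by_cases hyB : C.f y ∉ B
    · exact hloc y hyE hyB
    by_contra hyN
    obtain ⟨e, he⟩ := C.locally_power y
    have hev := eventually_notMem y B
    rw [eventually_nhdsWithin_iff] at hev
    obtain ⟨V, hV, hVsub, hVconn⟩ := he.exists_punctured_connected hev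
    obtain ⟨a, haV, haN⟩ := mem_closure_iff_nhds.1 hy V hV
    have hay : a ≠ y := fun h => hyN (h ▸ haN)
    have := eqOn_of_lifts hU.exists_injOn hVconn (g := id) (g' := h) continuousOn_id
      h.continuous.continuousOn (fun x hx => hVsub hx.1 hx.2) (fun x _ => (hh x).symm)
      ⟨haV, hay⟩ (show a = h a from (interior_subset haN).symm)
    refine hyN (mem_interior_iff_mem_nhds.2 (mem_of_superset hV fun x hx => ?_))
    by_cases hxy : x = y
    · rw [hxy]; exact hyE
    · exact (this ⟨hx, hxy⟩).symm
  have huniv := hclopen.eq_univ ⟨z, hloc z hfix hz⟩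
  ext y
  have hy : y ∈ E := interior_subset (huniv.ge (mem_univ y))
  exact hy

/-- Over a hemisphere, given as a disc with the branch points on its boundary, a covering has a
section. -/
theorem exists_section (hU : C.IsUnramifiedOutside (B : Set (OnePoint ℂ)))
    (hfin : ∀ x, (C.f ⁻¹' {x}).Finite) (hsurj : Function.Surjective C.f)
    {s : Disc → OnePoint ℂ} (hs : Continuous s)
    (hsB : ∀ w : Disc, s w ∈ B → (w : ℂ) ∈ range vertex) :
    ∃ σ : Disc → C.Z, Continuous σ ∧ ∀ w, C.f (σ w) = s w := by
  set A : Set ℂ := Metric.closedBall 0 1 \ range vertex with hA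
  have hAconv : Convex ℝ A := convex_diff_vertex (convex_closedBall _ _) subset_rfl subset_rfl
  have h0A : (0 : ℂ) ∈ A := by
    refine ⟨by simp, ?_⟩
    rintro ⟨k, hk⟩
    simpa [hk] using norm_vertex k
  have : LocallyPathConnectedSpace A := hAconv.locallyPathConnectedSpace
  have : ContractibleSpace A := hAconv.contractibleSpace ⟨0, h0A⟩
  have hcov : IsCoveringMapOn C.f (B : Set (OnePoint ℂ))ᶜ :=
    IsCoveringMapOn.of_isLocalHomeomorphOn C.continuous_f
      (isLocalHomeomorphOn_of_hasRamificationIndex_one fun z hz => hU z hz)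
  let sA : C(A, OnePoint ℂ) := ⟨fun a => s ⟨a, a.2.1⟩, by fun_prop⟩
  obtain ⟨e₀, he₀⟩ := hsurj (sA ⟨0, h0A⟩)
  obtain ⟨F, ⟨-, hF⟩, -⟩ := hcov.existsUnique_continuousMap_lifts sA he₀
    (fun a ha => a.2.2 (hsB _ ha))
  classical
  set σ₀ : ℂ → C.Z := fun w => if h : w ∈ A then F ⟨w, h⟩ else e₀ with hσ₀
  have hσ₀A : ∀ a : A, σ₀ a = F a := fun a => by simp only [hσ₀]; rw [dif_pos a.2]
  have hσ₀c : ContinuousOn σ₀ A := by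
    rw [continuousOn_iff_continuous_domRestrict]
    exact F.continuous.congr fun a => (hσ₀A a).symm
  have hfσ : ∀ w (h : w ∈ A), C.f (σ₀ w) = s ⟨w, h.1⟩ := fun w h => by
    rw [hσ₀A ⟨w, h⟩]; exact congrFun hF ⟨w, h⟩
  have hdense : Metric.closedBall (0 : ℂ) 1 ⊆ closure A := by
    have h1 : Metric.ball (0 : ℂ) 1 ⊆ A := fun w hw => ⟨Metric.ball_subset_closedBall hw, by
      rintro ⟨k, rfl⟩
      rw [mem_ball_zero_iff, norm_vertex] at hw
      exact lt_irrefl _ hw⟩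
    rw [← closure_ball (0 : ℂ) one_ne_zero]
    exact closure_mono h1
  have hlim : ∀ x ∈ Metric.closedBall (0 : ℂ) 1, ∃ y, Tendsto σ₀ (𝓝[A] x) (𝓝 y) := by
    intro x hx
    by_cases hxA : x ∈ A
    · exact ⟨_, hσ₀c x hxA⟩
    have : (𝓝[A] x).NeBot := mem_closure_iff_nhdsWithin_neBot.1 (hdense hx)
    refine exists_tendsto_of_finite_fiber C.continuous_f (hfin (s ⟨x, hx⟩)) ?_ ?_
    · have h1 : Tendsto (fun a : A => s ⟨a, a.2.1⟩) (comap (↑) (𝓝 x)) (𝓝 (s ⟨x, hx⟩)) := by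
        refine (hs.tendsto _).comp ?_
        rw [tendsto_subtype_rng]
        exact tendsto_comap
      rw [nhdsWithin, ← map_comap_setCoe_val]
      · exact (tendsto_map'_iff.2 (h1.congr fun a => (hfσ a a.2).symm))
    · intro t ht
      rw [Metric.mem_nhdsWithin_iff] at ht
      obtain ⟨ε, hε, hsub⟩ := ht
      refine ⟨_, inter_mem_nhdsWithin _ (Metric.ball_mem_nhds x hε), ?_, ?_⟩
      · rwa [inter_comm]
      · exact (hAconv.inter (convex_ball x ε)).isPreconnected.image _
          (hσ₀c.mono inter_subset_left)
  have hc := continuousOn_extendFrom hdense hlim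
  have hc' : Continuous fun w : Disc => extendFrom A σ₀ w :=
    continuousOn_iff_continuous_domRestrict.1 hc
  refine ⟨_, hc', fun w => ?_⟩
  have hd : Dense ((↑) ⁻¹' A : Set Disc) := by
    intro w
    rw [closure_subtype]
    have : ((↑) : Disc → ℂ) '' ((↑) ⁻¹' A) = A := by
      rw [Subtype.image_preimage_coe]
      exact inter_eq_right.2 sdiff_subset
    rw [this]
    exact hdense w.2
  refine congrFun (Continuous.ext_on hd (C.continuous_f.comp hc') hs fun a ha => ?_) w
  have h2 : extendFrom A σ₀ (a : ℂ) = σ₀ a := extendFrom_extends hσ₀c a ha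
  simp only [Function.comp_apply, h2]
  exact hfσ a ha

end SphereCovering

/-! ### Cutting a covering along the equator -/

/-- A presentation of a space as the double of the closed disc: two discs, indexed by `Bool`, glued
along their boundary circles. -/
structure DiscDouble (X : Type*) [TopologicalSpace X] where
  /-- The two discs. -/
  hemi : Bool → Disc → X
  continuous_hemi : ∀ ε, Continuous (hemi ε)
  hemi_eq_iff : ∀ ε ε' w w', hemi ε w = hemi ε' w' ↔ w = w' ∧ (ε = ε' ∨ ‖(w : ℂ)‖ = 1)
  exists_hemi : ∀ x, ∃ ε w, hemi ε w = x

/-- A vertex as a point of the closed disc. -/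
noncomputable def vertexPt (k : Fin 6) : Disc := ⟨vertex k, by simp [norm_vertex]⟩

/-- The branch points in `B` are the six vertices on the equator. -/
def DiscDouble.IsBranchedAt (D : DiscDouble (OnePoint ℂ)) (B : Finset (OnePoint ℂ)) : Prop :=
  ∀ x, x ∈ B ↔ ∃ k, D.hemi true (vertexPt k) = x

/-- A covering with group `D₇`, cut along the equator: an identification of the automorphism group
with `D₇` and sections over both hemispheres, which on the `k`-th arc differ by the
automorphism `G k`. -/
structure Cutting (D : DiscDouble (OnePoint ℂ)) (C : SphereCovering)
    (G : Fin 6 → DihedralGroup 7) where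
  /-- The action of the dihedral group. -/
  act : DihedralGroup 7 →* (C.Z ≃ₜ C.Z)
  act_injective : Function.Injective act
  range_act : act.range = C.deckGroup
  /-- The sections over the two hemispheres. -/
  sec : Bool → Disc → C.Z
  continuous_sec : ∀ ε, Continuous (sec ε)
  f_sec : ∀ ε w, C.f (sec ε w) = D.hemi ε w
  glue : ∀ k, ∀ w : Disc, (w : ℂ) ∈ arc k → sec false w = act (G k) (sec true w)

namespace DihedralCovering

variable {B : Finset (OnePoint ℂ)} (C : DihedralCovering B)

theorem unramified : C.1.IsUnramifiedOutside (B : Set (OnePoint ℂ)) := C.2.2.1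

theorem finite_fiber (x : OnePoint ℂ) : (C.1.f ⁻¹' {x}).Finite := by
  obtain ⟨m, ⟨s, e, hs, -⟩, -⟩ := C.2.1.2 x
  rw [← hs]
  exact s.finite_toSet

theorem ncard_fiber_of_notMem {x : OnePoint ℂ} (hx : x ∉ B) : (C.1.f ⁻¹' {x}).ncard = 14 := by
  obtain ⟨m, ⟨s, e, hs, he, hm⟩, hsum⟩ := C.2.1.2 x
  rw [DihedralGroup.nat_card] at hsum
  have h1 : ∀ z ∈ s, e z = 1 := fun z hz => by
    have hz' : z ∈ C.1.f ⁻¹' {x} := hs ▸ hz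
    refine (C.unramified z ?_).eq_one_of_one (he z hz)
    rw [show C.1.f z = x from hz']
    exact hx
  rw [← hs, Set.ncard_coe_finset]
  rw [← hm, ← Finset.sum_eq_multiset_sum, Finset.sum_congr rfl h1] at hsum
  simpa using hsum

theorem ncard_fiber_of_mem {x : OnePoint ℂ} (hx : x ∈ B) : (C.1.f ⁻¹' {x}).ncard = 7 := by
  obtain ⟨s, e, hs, he, hm⟩ := C.2.2.2 x hx
  rw [← hs, Set.ncard_coe_finset]
  have := congrArg Multiset.card hm
  simpa using this

theorem hasRamificationIndex_two {z : C.1.Z} (hz : C.1.f z ∈ B) :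
    HasRamificationIndex C.1.f z 2 := by
  obtain ⟨s, e, hs, he, hm⟩ := C.2.2.2 _ hz
  have hzs : z ∈ s := by
    have : z ∈ (s : Set C.1.Z) := by rw [hs]; rfl
    exact this
  have h2 : e z ∈ ({2, 2, 2, 2, 2, 2, 2} : Multiset ℕ) := hm ▸ Multiset.mem_map_of_mem e hzs
  have h3 : e z = 2 := by simpa using h2
  have h4 := he z hzs
  rw [h3] at h4
  exact h4

theorem f_surjective : Function.Surjective C.1.f := by
  intro x
  have : (C.1.f ⁻¹' {x}).Nonempty := by
    by_cases hx : x ∈ B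
    · exact Set.nonempty_of_ncard_ne_zero (by rw [C.ncard_fiber_of_mem hx]; norm_num)
    · exact Set.nonempty_of_ncard_ne_zero (by rw [C.ncard_fiber_of_notMem hx]; norm_num)
  exact this

/-- The group acts transitively on the unramified fibres. -/
theorem exists_act_eq {ρ : DihedralGroup 7 →* (C.1.Z ≃ₜ C.1.Z)} (hinj : Function.Injective ρ)
    (hρ : ∀ g z, C.1.f (ρ g z) = C.1.f z) (hmem : ∀ g, ρ g ∈ C.1.deckGroup)
    {z z' : C.1.Z} (hz : C.1.f z ∉ B) (h : C.1.f z' = C.1.f z) : ∃ g, ρ g z = z' := by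
  have hfin := C.finite_fiber (C.1.f z)
  have hi : Function.Injective fun g => ρ g z := by
    intro g g' hgg
    have h1 : ρ (g'⁻¹ * g) = 1 := by
      refine SphereCovering.deck_eq_one C.unramified (hmem _) hz ?_
      have : ρ g z = ρ g' z := hgg
      rw [map_mul, map_inv, Homeomorph.mul_apply, this]
      exact (ρ g').symm_apply_apply z
    rw [← map_one ρ] at h1
    exact (inv_mul_eq_one.1 (hinj h1)).symm
  have hr : (range fun g => ρ g z) = C.1.f ⁻¹' {C.1.f z} := by
    refine Set.eq_of_subset_of_ncard_le ?_ ?_ hfin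
    · rintro _ ⟨g, rfl⟩
      exact hρ g z
    · rw [C.ncard_fiber_of_notMem hz, ← image_univ, Set.ncard_image_of_injective _ hi,
        Set.ncard_univ, DihedralGroup.nat_card]
  exact hr.ge h

end DihedralCovering

namespace Cutting

variable {D : DiscDouble (OnePoint ℂ)} {B : Finset (OnePoint ℂ)} {G : Fin 6 → DihedralGroup 7}

theorem act_mem {C : SphereCovering} (c : Cutting D C G) (g : DihedralGroup 7) :
    c.act g ∈ C.deckGroup := c.range_act ▸ ⟨g, rfl⟩

theorem f_act {C : SphereCovering} (c : Cutting D C G) (g : DihedralGroup 7) (z : C.Z) :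
    C.f (c.act g z) = C.f z := c.act_mem g z

theorem act_mul {C : SphereCovering} (c : Cutting D C G) (g h : DihedralGroup 7) (z : C.Z) :
    c.act (g * h) z = c.act g (c.act h z) := by rw [map_mul]; rfl

theorem act_inv_eq {C : SphereCovering} (c : Cutting D C G) {g : DihedralGroup 7} {z z' : C.Z} :
    c.act g⁻¹ z = z' ↔ z = c.act g z' := by
  rw [map_inv]
  exact (c.act g).symm_apply_eq

theorem act_one {C : SphereCovering} (c : Cutting D C G) (z : C.Z) : c.act 1 z = z := by
  rw [map_one]; rfl

/-- Elements of a fibre in the same translate. -/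
theorem act_eq_act {C : SphereCovering} (c : Cutting D C G) {g h : DihedralGroup 7} {z : C.Z} :
    c.act g z = c.act h z ↔ c.act (h⁻¹ * g) z = z := by
  rw [c.act_mul, c.act_inv_eq]

end Cutting

section Branched

variable {D : DiscDouble (OnePoint ℂ)} {B : Finset (OnePoint ℂ)}

theorem DiscDouble.IsBranchedAt.hemi_mem (hB : D.IsBranchedAt B) {ε : Bool} {w : Disc} :
    D.hemi ε w ∈ B ↔ ∃ k, w = vertexPt k := by
  rw [hB]
  constructor
  · rintro ⟨k, hk⟩
    exact ⟨k, ((D.hemi_eq_iff _ _ _ _).1 hk).1.symm⟩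
  · rintro ⟨k, rfl⟩
    exact ⟨k, (D.hemi_eq_iff _ _ _ _).2 ⟨rfl, Or.inr (norm_vertex k)⟩⟩

theorem vertexPt_mem_arc (k : Fin 6) :
    (vertexPt k : ℂ) ∈ arc k ∧ (vertexPt k : ℂ) ∈ arc (k + 1) :=
  ⟨(vertex_mem_arc_iff k k).2 (Or.inl rfl), (vertex_mem_arc_iff k (k + 1)).2 (Or.inr rfl)⟩

/-- The centre of the disc. -/
noncomputable def discZero : Disc := ⟨0, by simp⟩

theorem hemi_discZero_notMem (hB : D.IsBranchedAt B) (ε : Bool) : D.hemi ε discZero ∉ B := by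
  rw [hB.hemi_mem]
  rintro ⟨k, hk⟩
  have := norm_vertex k
  rw [show vertex k = 0 from (congrArg Subtype.val hk).symm] at this
  simp at this

/-- The disc without the vertices is connected and dense. -/
theorem isPreconnected_disc_diff_vertex :
    IsPreconnected {w : Disc | (w : ℂ) ∉ range vertex} ∧
      Dense {w : Disc | (w : ℂ) ∉ range vertex} := by
  have himg : ((↑) : Disc → ℂ) '' {w : Disc | (w : ℂ) ∉ range vertex} =
      Metric.closedBall 0 1 \ range vertex := by
    ext w
    constructor
    · rintro ⟨w, hw, rfl⟩
      exact ⟨w.2, hw⟩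
    · rintro ⟨h1, h2⟩
      exact ⟨⟨w, h1⟩, h2, rfl⟩
  constructor
  · rw [← IsInducing.subtypeVal.isPreconnected_image, himg]
    exact (convex_diff_vertex (convex_closedBall _ _) subset_rfl subset_rfl).isPreconnected
  · intro w
    rw [closure_subtype, himg]
    have h1 : Metric.ball (0 : ℂ) 1 ⊆ Metric.closedBall 0 1 \ range vertex :=
      fun w hw => ⟨Metric.ball_subset_closedBall hw, by
        rintro ⟨k, rfl⟩
        rw [mem_ball_zero_iff, norm_vertex] at hw
        exact lt_irrefl _ hw⟩
    have h2 : (w : ℂ) ∈ closure (Metric.ball (0 : ℂ) 1) := by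
      rw [closure_ball (0 : ℂ) one_ne_zero]; exact w.2
    exact closure_mono h1 h2

/-- Two maps on the disc lifting the same hemisphere differ by an automorphism. -/
theorem exists_act_sec_eq (hB : D.IsBranchedAt B) (C : DihedralCovering B)
    {ρ : DihedralGroup 7 →* (C.1.Z ≃ₜ C.1.Z)} (hinj : Function.Injective ρ)
    (hρ : ∀ g, ρ g ∈ C.1.deckGroup) {ε : Bool} {σ σ' : Disc → C.1.Z} (hσ : Continuous σ)
    (hσ' : Continuous σ') (hf : ∀ w, C.1.f (σ w) = D.hemi ε w)
    (hf' : ∀ w, C.1.f (σ' w) = D.hemi ε w) : ∃ g, ∀ w, σ' w = ρ g (σ w) := by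
  obtain ⟨g, hg⟩ := C.exists_act_eq hinj (fun g z => hρ g z) hρ (z := σ discZero)
    (z' := σ' discZero) (by rw [hf]; exact hemi_discZero_notMem hB ε) (by rw [hf, hf'])
  have h0 : discZero ∈ {w : Disc | (w : ℂ) ∉ range vertex} := by
    rintro ⟨k, hk⟩
    have h1 : vertex k = 0 := hk
    simpa [h1] using norm_vertex k
  have hcont : Continuous fun w => ρ g (σ w) := (ρ g).continuous.comp hσ
  have h := eqOn_of_lifts C.unramified.exists_injOn isPreconnected_disc_diff_vertex.1
    hσ'.continuousOn hcont.continuousOn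
    (fun w hw => by
      rw [mem_preimage, hf', mem_compl_iff, Finset.mem_coe, hB.hemi_mem]
      rintro ⟨k, rfl⟩
      exact hw ⟨k, rfl⟩)
    (fun w _ => by rw [hf', hρ g, hf]) h0 hg.symm
  exact ⟨g, congrFun (Continuous.ext_on isPreconnected_disc_diff_vertex.2 hσ' hcont h)⟩

/-- Every covering can be cut along the equator. -/
theorem exists_cutting (hB : D.IsBranchedAt B) (C : DihedralCovering B) :
    ∃ G, Nonempty (Cutting D C.1 G) := by
  obtain ⟨⟨θ⟩, -⟩ := C.2.1
  let ρ : DihedralGroup 7 →* (C.1.Z ≃ₜ C.1.Z) := C.1.deckGroup.subtype.comp θ.symm.toMonoidHom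
  have hinj : Function.Injective ρ := Subtype.val_injective.comp θ.symm.injective
  have hmem : ∀ g, ρ g ∈ C.1.deckGroup := fun g => (θ.symm g).2
  have hrange : ρ.range = C.1.deckGroup := by
    ext h
    constructor
    · rintro ⟨g, rfl⟩; exact hmem g
    · intro hh
      exact ⟨θ ⟨h, hh⟩, by simp [ρ]⟩
  have hsec : ∀ ε, ∃ σ : Disc → C.1.Z, Continuous σ ∧ ∀ w, C.1.f (σ w) = D.hemi ε w := fun ε =>
    SphereCovering.exists_section C.unramified C.finite_fiber C.f_surjective (D.continuous_hemi ε)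
      (fun w hw => by
        obtain ⟨k, rfl⟩ := hB.hemi_mem.1 hw
        exact ⟨k, rfl⟩)
  choose σ hσ hfσ using hsec
  have hglue : ∀ k, ∃ g, ∀ w : Disc, (w : ℂ) ∈ arc k → σ false w = ρ g (σ true w) := by
    intro k
    obtain ⟨A, hAk, hA, ⟨a, ha⟩, hdisj, hcl⟩ := exists_arc_interior k
    have hk1 : arc k ⊆ Metric.closedBall 0 1 := fun w hw => by
      simp [norm_eq_one_of_mem_arc hw]
    have hff : ∀ w : Disc, (w : ℂ) ∈ arc k → C.1.f (σ false w) = C.1.f (σ true w) := fun w hw => by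
      rw [hfσ, hfσ, D.hemi_eq_iff]
      exact ⟨rfl, Or.inr (norm_eq_one_of_mem_arc hw)⟩
    have hAB : ∀ w : Disc, (w : ℂ) ∈ A → C.1.f (σ false w) ∉ B := fun w hw => by
      rw [hfσ, hB.hemi_mem]
      rintro ⟨j, rfl⟩
      exact Set.disjoint_left.1 hdisj hw ⟨j, rfl⟩
    let A' : Set Disc := (↑) ⁻¹' A
    have hA'img : ((↑) : Disc → ℂ) '' A' = A := by
      rw [Subtype.image_preimage_coe]
      exact inter_eq_right.2 (hAk.trans hk1)
    have hA' : IsPreconnected A' := by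
      rw [← IsInducing.subtypeVal.isPreconnected_image, hA'img]; exact hA
    let a' : Disc := ⟨a, hk1 (hAk ha)⟩
    obtain ⟨g, hg⟩ := C.exists_act_eq hinj (fun g z => hmem g z) hmem (z := σ true a')
      (z' := σ false a') (by rw [← hff a' (hAk ha)]; exact hAB a' ha) (hff a' (hAk ha))
    have hcont : Continuous fun w => ρ g (σ true w) := (ρ g).continuous.comp (hσ true)
    have h := eqOn_of_lifts C.unramified.exists_injOn hA' (hσ false).continuousOn
      hcont.continuousOn (fun w hw => hAB w hw)
      (fun w hw => by rw [hmem g, hff w (hAk hw)]) (show a' ∈ A' from ha) hg.symm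
    refine ⟨g, fun w hw => h.closure (hσ false) hcont ?_⟩
    rw [closure_subtype, hA'img]
    exact hcl hw
  choose G hG using hglue
  exact ⟨G, ⟨⟨ρ, hinj, hrange, σ, hσ, hfσ, hG⟩⟩⟩

end Branched

/-! ### Comparing two cuttings -/

namespace Cutting

variable {D : DiscDouble (OnePoint ℂ)} {B : Finset (OnePoint ℂ)} {G : Fin 6 → DihedralGroup 7}

/-- The translates of the two sections cover the whole space: their union is closed and contains
the dense set of unramified points. -/
theorem exists_eq_act_sec {C : DihedralCovering B} (c : Cutting D C.1 G)
    (z : C.1.Z) : ∃ g ε w, z = c.act g (c.sec ε w) := by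
  set T : Set C.1.Z := ⋃ p : DihedralGroup 7 × Bool, range fun w => c.act p.1 (c.sec p.2 w)
    with hT
  have hTc : IsClosed T := isClosed_iUnion_of_finite fun p =>
    (isCompact_range ((c.act p.1).continuous.comp (c.continuous_sec p.2))).isClosed
  have hunr : ∀ y, C.1.f y ∉ B → y ∈ T := by
    intro y hy
    obtain ⟨ε, w, hw⟩ := D.exists_hemi (C.1.f y)
    obtain ⟨g, hg⟩ := C.exists_act_eq c.act_injective c.f_act c.act_mem (z := c.sec ε w) (z' := y)
      (by rw [c.f_sec, hw]; exact hy) (by rw [c.f_sec, hw])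
    exact mem_iUnion.2 ⟨(g, ε), w, hg⟩
  have hz : z ∈ T := by
    refine hTc.closure_subset ?_
    obtain ⟨e, he⟩ := C.1.locally_power z
    have := he.neBot
    have h1 : ∃ᶠ y in 𝓝[≠] z, y ∈ T :=
      ((SphereCovering.eventually_notMem z B).mono hunr).frequently
    exact mem_closure_iff_frequently.2 (h1.filter_mono nhdsWithin_le_nhds)
  obtain ⟨p, w, hw⟩ := mem_iUnion.1 hz
  exact ⟨p.1, p.2, w, hw.symm⟩

theorem act_eq_self_of_notMem {C : DihedralCovering B} (c : Cutting D C.1 G) {z : C.1.Z}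
    (hz : C.1.f z ∉ B) {g : DihedralGroup 7} (h : c.act g z = z) : g = 1 :=
  c.act_injective ((SphereCovering.deck_eq_one C.unramified (c.act_mem g) hz h).trans
    (map_one c.act).symm)

/-- The product of the gluing elements of two adjacent arcs stabilises the point over their common
vertex. -/
theorem act_vertex {C : SphereCovering} (c : Cutting D C G) (k : Fin 6) :
    c.act ((G k)⁻¹ * G (k + 1)) (c.sec true (vertexPt k)) = c.sec true (vertexPt k) := by
  rw [← c.act_eq_act, ← c.glue _ _ (vertexPt_mem_arc k).2, ← c.glue _ _ (vertexPt_mem_arc k).1]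

/-- The stabiliser of a point over a vertex has order two, since the fibre has seven elements. -/
theorem eq_one_or_eq_of_act_vertex (hB : D.IsBranchedAt B) {C : DihedralCovering B}
    (c : Cutting D C.1 G) (k : Fin 6) {g h : DihedralGroup 7} (hh1 : h ≠ 1)
    (hh : c.act h (c.sec true (vertexPt k)) = c.sec true (vertexPt k))
    (hg : c.act g (c.sec true (vertexPt k)) = c.sec true (vertexPt k)) : g = 1 ∨ g = h := by
  set z := c.sec true (vertexPt k) with hz
  let _ : MulAction (DihedralGroup 7) C.1.Z :=
    { smul := fun g y => c.act g y
      one_smul := c.act_one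
      mul_smul := c.act_mul }
  have horb : MulAction.orbit (DihedralGroup 7) z = C.1.f ⁻¹' {C.1.f z} := by
    ext y
    constructor
    · rintro ⟨g, rfl⟩
      exact c.f_act g z
    · intro hy
      obtain ⟨g, ε, w, rfl⟩ := c.exists_eq_act_sec y
      have h1 : C.1.f (c.sec ε w) = C.1.f z := (c.f_act g _).symm.trans hy
      rw [hz, c.f_sec, c.f_sec, D.hemi_eq_iff] at h1
      obtain ⟨rfl, -⟩ := h1
      cases ε
      · rw [c.glue k _ (vertexPt_mem_arc k).1, ← c.act_mul]
        exact ⟨g * G k, rfl⟩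
      · exact ⟨g, rfl⟩
  have hcard : (MulAction.orbit (DihedralGroup 7) z).ncard = 7 := by
    rw [horb]
    refine C.ncard_fiber_of_mem ?_
    rw [hz, c.f_sec]
    exact hB.hemi_mem.2 ⟨k, rfl⟩
  have h2 : Nat.card (MulAction.stabilizer (DihedralGroup 7) z) = 2 := by
    have h3 := (MulAction.stabilizer (DihedralGroup 7) z).card_mul_index
    rw [MulAction.index_stabilizer, hcard, DihedralGroup.nat_card] at h3
    omega
  obtain ⟨a, b, hab, huniv⟩ := Nat.card_eq_two_iff.1 h2
  have hall : ∀ x : MulAction.stabilizer (DihedralGroup 7) z, x = a ∨ x = b := fun x => by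
    have : x ∈ ({a, b} : Set _) := huniv ▸ mem_univ x
    simpa using this
  have e1 := hall 1
  have e2 := hall ⟨h, hh⟩
  have e3 := hall ⟨g, hg⟩
  have n12 : (1 : MulAction.stabilizer (DihedralGroup 7) z) ≠ ⟨h, hh⟩ := fun h' =>
    hh1 (congrArg Subtype.val h').symm
  have : (⟨g, hg⟩ : MulAction.stabilizer (DihedralGroup 7) z) = 1 ∨
      (⟨g, hg⟩ : MulAction.stabilizer (DihedralGroup 7) z) = ⟨h, hh⟩ := by
    rcases e1 with e1 | e1 <;> rcases e2 with e2 | e2 <;> rcases e3 with e3 | e3 <;>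
      simp_all
  exact this.imp (congrArg Subtype.val) (congrArg Subtype.val)

/-- At a branch point the gluing elements of the two adjacent arcs differ: otherwise the two
sections would fit together to a section around the vertex. -/
theorem inv_mul_ne_one (hB : D.IsBranchedAt B) {C : DihedralCovering B}
    (c : Cutting D C.1 G) (k : Fin 6) : (G k)⁻¹ * G (k + 1) ≠ 1 := by
  intro hG
  have hG' : G (k + 1) = G k := (inv_mul_eq_one.1 hG).symm
  obtain ⟨ε, hε, hball⟩ := exists_ball_subset_arc k
  set K : Set Disc := {w | (w : ℂ) ∈ Metric.closedBall (vertex k) ε} with hK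
  have hKc : IsCompact K := (Metric.isClosed_closedBall.preimage continuous_subtype_val).isCompact
  let τ : Bool → Disc → C.1.Z := fun b w => bif b then c.act (G k) (c.sec true w) else c.sec false w
  have hτ : ∀ b, Continuous (τ b) := by
    rintro (_ | _)
    · exact c.continuous_sec false
    · exact (c.act (G k)).continuous.comp (c.continuous_sec true)
  have hfτ : ∀ b w, C.1.f (τ b w) = D.hemi b w := by
    rintro (_ | _) w
    · exact c.f_sec false w
    · exact (c.f_act _ _).trans (c.f_sec true w)
  have hglue : ∀ w ∈ K, ‖(w : ℂ)‖ = 1 → τ false w = τ true w := by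
    intro w hw h1
    rcases hball _ hw h1 with h | h
    · exact c.glue k w h
    · exact (c.glue (k + 1) w h).trans (by rw [hG']; rfl)
  have hvK : vertexPt k ∈ K := Metric.mem_closedBall_self hε.le
  set T : Set C.1.Z := ⋃ b : Bool, τ b '' K with hT
  have hTc : IsCompact T := isCompact_iUnion fun b => hKc.image (hτ b)
  refine (C.hasRamificationIndex_two (z := τ false (vertexPt k)) ?_).not_injOn_of_isCompact
    C.1.continuous_f hTc (mem_iUnion.2 ⟨false, _, hvK, rfl⟩) ?_ ?_
  · rw [hfτ]; exact hB.hemi_mem.2 ⟨k, rfl⟩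
  · set L : Set Disc := {w | (w : ℂ) ∉ Metric.ball (vertex k) ε} with hL
    have hLc : IsCompact L :=
      (Metric.isOpen_ball.preimage continuous_subtype_val).isClosed_compl.isCompact
    have hcl : IsClosed (⋃ b, D.hemi b '' L) :=
      (isCompact_iUnion fun b => hLc.image (D.continuous_hemi b)).isClosed
    refine mem_of_superset (hcl.isOpen_compl.mem_nhds ?_) ?_
    · simp only [mem_compl_iff, mem_iUnion, not_exists]
      rintro b ⟨w, hw, hwv⟩
      rw [hfτ, D.hemi_eq_iff] at hwv
      rw [hwv.1] at hw
      exact hw (Metric.mem_ball_self hε)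
    · intro x hx
      obtain ⟨b, w, rfl⟩ := D.exists_hemi x
      have hw : w ∈ K := by
        by_contra hwK
        exact hx (mem_iUnion.2 ⟨b, w, fun h => hwK (Metric.ball_subset_closedBall h), rfl⟩)
      exact ⟨τ b w, mem_iUnion.2 ⟨b, w, hw, rfl⟩, hfτ b w⟩
  · intro x hx y hy hxy
    obtain ⟨b, w, hw, rfl⟩ := mem_iUnion.1 hx
    obtain ⟨b', w', hw', rfl⟩ := mem_iUnion.1 hy
    rw [hfτ, hfτ, D.hemi_eq_iff] at hxy
    obtain ⟨rfl, rfl | h1⟩ := hxy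
    · rfl
    · have := hglue w hw h1
      cases b <;> cases b' <;> simp [this]

/-- The gluing elements determine all coincidences between translates of the two sections, hence the
kernel of the surjection from the disjoint union of discs onto the covering. -/
theorem eq_of_eq (hB : D.IsBranchedAt B) {C C' : DihedralCovering B} (c : Cutting D C.1 G)
    (c' : Cutting D C'.1 G) {g g' : DihedralGroup 7} {ε ε' : Bool} {w w' : Disc}
    (h : c.act g (c.sec ε w) = c.act g' (c.sec ε' w')) :
    c'.act g (c'.sec ε w) = c'.act g' (c'.sec ε' w') := by
  have h1 : D.hemi ε w = D.hemi ε' w' := by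
    rw [← c.f_sec ε w, ← c.f_sec ε' w', ← c.f_act g (c.sec ε w), h, c.f_act]
  obtain ⟨rfl, hε⟩ := (D.hemi_eq_iff _ _ _ _).1 h1
  -- two translates of the same section
  have same : ∀ (g g' : DihedralGroup 7) (ε : Bool),
      (ε = true ∨ ∀ k, w ≠ vertexPt k) → c.act g (c.sec ε w) = c.act g' (c.sec ε w) →
      c'.act g (c'.sec ε w) = c'.act g' (c'.sec ε w) := by
    intro g g' ε hεw h
    rw [c.act_eq_act] at h
    rw [c'.act_eq_act]
    by_cases hw : ∃ k, w = vertexPt k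
    · obtain ⟨k, rfl⟩ := hw
      obtain rfl : ε = true := hεw.resolve_right fun h => h k rfl
      rcases c.eq_one_or_eq_of_act_vertex hB k (c.inv_mul_ne_one hB k) (c.act_vertex k) h
        with h2 | h2
      · rw [h2, c'.act_one]
      · rw [h2, c'.act_vertex]
    · rw [c.act_eq_self_of_notMem (by rw [c.f_sec, hB.hemi_mem]; exact hw) h, c'.act_one]
  by_cases hw : ‖(w : ℂ)‖ = 1
  · obtain ⟨k, hk⟩ := exists_mem_arc hw
    have e := c.glue k w hk
    have e' := c'.glue k w hk
    cases ε <;> cases ε'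
    · rw [e, ← c.act_mul, ← c.act_mul] at h
      rw [e', ← c'.act_mul, ← c'.act_mul]
      exact same _ _ _ (Or.inl rfl) h
    · rw [e, ← c.act_mul] at h
      rw [e', ← c'.act_mul]
      exact same _ _ _ (Or.inl rfl) h
    · rw [e, ← c.act_mul] at h
      rw [e', ← c'.act_mul]
      exact same _ _ _ (Or.inl rfl) h
    · exact same _ _ _ (Or.inl rfl) h
  · obtain rfl := hε.resolve_right hw
    refine same _ _ _ (Or.inr ?_) h
    rintro k rfl
    exact hw (norm_vertex k)

/-- Coverings with the same gluing elements are isomorphic: both are the same quotient of a disjoint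
union of discs. -/
theorem isomorphic (hB : D.IsBranchedAt B) {C C' : DihedralCovering B} (c : Cutting D C.1 G)
    (c' : Cutting D C'.1 G) : C.1.Isomorphic C'.1 := by
  classical
  let I := Σ _ : DihedralGroup 7 × Bool, Disc
  let q : I → C.1.Z := fun p => c.act p.1.1 (c.sec p.1.2 p.2)
  let q' : I → C'.1.Z := fun p => c'.act p.1.1 (c'.sec p.1.2 p.2)
  have hq : Continuous q := continuous_sigma fun p =>
    (c.act p.1).continuous.comp (c.continuous_sec p.2)
  have hq' : Continuous q' := continuous_sigma fun p =>
    (c'.act p.1).continuous.comp (c'.continuous_sec p.2)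
  have hsurj : Function.Surjective q := fun z => by
    obtain ⟨g, ε, w, h⟩ := c.exists_eq_act_sec z
    exact ⟨⟨(g, ε), w⟩, h.symm⟩
  have hsurj' : Function.Surjective q' := fun z => by
    obtain ⟨g, ε, w, h⟩ := c'.exists_eq_act_sec z
    exact ⟨⟨(g, ε), w⟩, h.symm⟩
  have hquot : IsQuotientMap q := hq.isClosedMap.isQuotientMap hq hsurj
  choose r hr using hsurj
  have hrq : ∀ p, q' (r (q p)) = q' p := fun p => c.eq_of_eq hB c' (hr (q p))
  let F : C.1.Z → C'.1.Z := fun z => q' (r z)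
  have hF : Continuous F := by
    rw [hquot.continuous_iff]
    exact hq'.congr fun p => (hrq p).symm
  have hFinj : Function.Injective F := fun z z' h => by
    have := c'.eq_of_eq hB c h
    exact (hr z).symm.trans (this.trans (hr z'))
  have hFsurj : Function.Surjective F := fun z' => by
    obtain ⟨p, rfl⟩ := hsurj' z'
    exact ⟨q p, hrq p⟩
  refine ⟨hF.homeoOfEquivCompactToT2 (f := Equiv.ofBijective F ⟨hFinj, hFsurj⟩), fun z => ?_⟩
  have h1 : C'.1.f (F z) = C.1.f (q (r z)) := by
    simp only [F, q, q', c.f_act, c'.f_act, c.f_sec, c'.f_sec]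
  rw [hr] at h1
  exact h1

/-- An isomorphism transports cuttings. -/
theorem nonempty_of_isomorphic {C C' : SphereCovering} (c : Cutting D C G)
    (h : C.Isomorphic C') : Nonempty (Cutting D C' G) := by
  obtain ⟨h, hh⟩ := h
  have hsymm : ∀ z, C.f (h.symm z) = C'.f z := fun z => by rw [← hh, h.apply_symm_apply]
  refine ⟨
    { act :=
        { toFun := fun g => (h.symm.trans (c.act g)).trans h
          map_one' := by ext z; simp
          map_mul' := fun a b => by ext z; simp }
      act_injective := fun a b hab => c.act_injective ?_
      range_act := ?_
      sec := fun ε w => h (c.sec ε w)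
      continuous_sec := fun ε => h.continuous.comp (c.continuous_sec ε)
      f_sec := fun ε w => (hh _).trans (c.f_sec ε w)
      glue := fun k w hw => ?_ }⟩
  · ext z
    have := DFunLike.congr_fun hab (h z)
    simpa using this
  · ext u
    constructor
    · rintro ⟨g, rfl⟩ z
      exact (hh _).trans ((c.f_act g _).trans (hsymm z))
    · intro hu
      have : (h.trans u).trans h.symm ∈ C.deckGroup := fun z => by
        rw [Homeomorph.trans_apply, Homeomorph.trans_apply, hsymm, hu, hh]
      rw [← c.range_act] at this
      obtain ⟨g, hg⟩ := this
      refine ⟨g, ?_⟩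
      ext z
      have e := DFunLike.congr_fun hg (h.symm z)
      simp only [Homeomorph.trans_apply, Homeomorph.apply_symm_apply] at e
      simp [e]
  · simp [c.glue k w hw]

/-- Changing the identification of the automorphism group. -/
theorem nonempty_map {C : SphereCovering} (c : Cutting D C G)
    (β : DihedralGroup 7 ≃* DihedralGroup 7) : Nonempty (Cutting D C fun k => β (G k)) :=
  ⟨{ act := c.act.comp β.symm.toMonoidHom
     act_injective := c.act_injective.comp β.symm.injective
     range_act := by
      rw [← c.range_act]
      ext u
      constructor
      · rintro ⟨g, rfl⟩; exact ⟨β.symm g, rfl⟩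
      · rintro ⟨g, rfl⟩; exact ⟨β g, by simp⟩
     sec := c.sec
     continuous_sec := c.continuous_sec
     f_sec := c.f_sec
     glue := fun k w hw => by simpa using c.glue k w hw }⟩

/-- Changing the section over the second hemisphere. -/
theorem nonempty_mul {C : SphereCovering} (c : Cutting D C G) (g : DihedralGroup 7) :
    Nonempty (Cutting D C fun k => g * G k) :=
  ⟨{ act := c.act
     act_injective := c.act_injective
     range_act := c.range_act
     sec := fun ε w => bif ε then c.sec true w else c.act g (c.sec false w)
     continuous_sec := by
      rintro (_ | _)
      · exact (c.act g).continuous.comp (c.continuous_sec false)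
      · exact c.continuous_sec true
     f_sec := by
      rintro (_ | _) w
      · exact (c.f_act _ _).trans (c.f_sec false w)
      · exact c.f_sec true w
     glue := fun k w hw => by
      simp only [cond_false, cond_true]
      rw [c.glue k w hw, c.act_mul] }⟩

/-- Two cuttings of the same covering differ by an automorphism of the dihedral group and by the
choice of the two sections. -/
theorem exists_mulEquiv (hB : D.IsBranchedAt B) {C : DihedralCovering B}
    {G' : Fin 6 → DihedralGroup 7} (c : Cutting D C.1 G) (c' : Cutting D C.1 G') :
    ∃ (β : DihedralGroup 7 ≃* DihedralGroup 7) (a b : DihedralGroup 7),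
      ∀ k, G' k = β (a * G k * b⁻¹) := by
  let e : DihedralGroup 7 ≃* C.1.deckGroup :=
    (MonoidHom.ofInjective c.act_injective).trans (MulEquiv.subgroupCongr c.range_act)
  let e' : DihedralGroup 7 ≃* C.1.deckGroup :=
    (MonoidHom.ofInjective c'.act_injective).trans (MulEquiv.subgroupCongr c'.range_act)
  have he : ∀ g, (e g : C.1.Z ≃ₜ C.1.Z) = c.act g := fun g => rfl
  have he' : ∀ g, (e' g : C.1.Z ≃ₜ C.1.Z) = c'.act g := fun g => rfl
  let β : DihedralGroup 7 ≃* DihedralGroup 7 := e.trans e'.symm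
  have hβ : ∀ g, c'.act (β g) = c.act g := fun g => by
    rw [← he', ← he]; simp [β]
  obtain ⟨b, hb⟩ := exists_act_sec_eq hB C c.act_injective c.act_mem (c.continuous_sec true)
    (c'.continuous_sec true) (c.f_sec true) (c'.f_sec true)
  obtain ⟨a, ha⟩ := exists_act_sec_eq hB C c.act_injective c.act_mem (c.continuous_sec false)
    (c'.continuous_sec false) (c.f_sec false) (c'.f_sec false)
  refine ⟨β, a, b, fun k => ?_⟩
  obtain ⟨A, hAk, -, ⟨w, hw⟩, hdisj, -⟩ := exists_arc_interior k
  have hwk := hAk hw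
  let w' : Disc := ⟨w, by simp [norm_eq_one_of_mem_arc hwk]⟩
  have h1 := c'.glue k w' hwk
  rw [ha, hb, c.glue k w' hwk] at h1
  rw [← inv_mul_eq_one]
  refine c'.act_eq_self_of_notMem (z := c'.sec true w') ?_ ?_
  · rw [c'.f_sec, hB.hemi_mem]
    rintro ⟨j, hj⟩
    exact Set.disjoint_left.1 hdisj hw ⟨j, (congrArg Subtype.val hj).symm⟩
  · rw [c'.act_mul, c'.act_inv_eq, hβ, hb, c.act_mul, c.act_mul, c.act_inv_eq.2 rfl]
    exact h1

end Cutting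

/-! ### Normal form of the gluing elements -/

section Dihedral

/-- Normalised gluing elements: trivial on the arc `0`, the reflection `sr 0` on the opposite arc
`3`, and alternately rotations and reflections throughout. -/
def gluing (v : Fin 4 → ZMod 7) : Fin 6 → DihedralGroup 7 :=
  ![1, .sr (v 0), .r (v 1), .sr 0, .r (v 2), .sr (v 3)]

/-- The automorphism of the dihedral group that multiplies all parameters by a unit. -/
def dihedralScale (u : (ZMod 7)ˣ) : DihedralGroup 7 ≃* DihedralGroup 7 where
  toFun
    | .r i => .r (u * i)
    | .sr i => .sr (u * i)
  invFun
    | .r i => .r (↑u⁻¹ * i)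
    | .sr i => .sr (↑u⁻¹ * i)
  left_inv := by
    rintro (i | i)
    · exact congrArg DihedralGroup.r (u.inv_mul_cancel_left i)
    · exact congrArg DihedralGroup.sr (u.inv_mul_cancel_left i)
  right_inv := by
    rintro (i | i)
    · exact congrArg DihedralGroup.r (u.mul_inv_cancel_left i)
    · exact congrArg DihedralGroup.sr (u.mul_inv_cancel_left i)
  map_mul' := by
    rintro (i | i) (j | j) <;> simp [mul_add, mul_sub]

theorem dihedralScale_gluing (u : (ZMod 7)ˣ) (v : Fin 4 → ZMod 7) :
    (fun k => dihedralScale u (gluing v k)) = gluing ((u : ZMod 7) • v) := by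
  funext k
  fin_cases k
  · exact map_one (dihedralScale u)
  · rfl
  · rfl
  · exact congrArg DihedralGroup.sr (mul_zero (u : ZMod 7))
  · rfl
  · rfl

theorem dihedral_eq_sr_of_mul_self {h : DihedralGroup 7} (h1 : h ≠ 1) (h2 : h * h = 1) :
    ∃ i, h = .sr i := by
  rcases h with i | i
  · rw [DihedralGroup.r_mul_r, DihedralGroup.one_def] at h2
    have h3 : i + i = 0 := DihedralGroup.r.inj h2
    have h4 : i = 0 := by revert h3; revert i; decide
    exact absurd (by rw [h4]; rfl) h1
  · exact ⟨i, rfl⟩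

/-- An automorphism of the dihedral group that fixes `sr 0` is a scaling. -/
theorem exists_scale_of_fixes {β : DihedralGroup 7 ≃* DihedralGroup 7} (h : β (.sr 0) = .sr 0) :
    ∃ u : (ZMod 7)ˣ, ∀ i, β (.r i) = .r (u * i) ∧ β (.sr i) = .sr (u * i) := by
  obtain ⟨u, hu⟩ : ∃ u, β (.r 1) = .r u := by
    rcases e : β (.r 1) with u | u
    · exact ⟨u, rfl⟩
    · have h1 : β (.r 1 * .r 1) = β 1 := by
        rw [map_mul, e, map_one, DihedralGroup.sr_mul_sr, sub_self]; rfl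
      exact absurd (β.injective h1) (by decide)
  have hr : ∀ i, β (.r i) = .r (u * i) := by
    intro i
    have h1 : (DihedralGroup.r i : DihedralGroup 7) = .r 1 ^ i.val := by
      rw [DihedralGroup.r_one_pow, ZMod.natCast_zmod_val]
    rw [h1, map_pow, hu, DihedralGroup.r_pow, ZMod.natCast_zmod_val]
  have hu0 : u ≠ 0 := by
    rintro rfl
    exact absurd (β.injective (hu.trans (map_one β).symm)) (by decide)
  refine ⟨Units.mk0 u hu0, fun i => ⟨hr i, ?_⟩⟩
  have h1 : (DihedralGroup.sr i : DihedralGroup 7) = .sr 0 * .r i := by simp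
  rw [h1, map_mul, h, hr]
  simp

end Dihedral

namespace Cutting

variable {D : DiscDouble (OnePoint ℂ)} {B : Finset (OnePoint ℂ)} {G : Fin 6 → DihedralGroup 7}

/-- The local monodromy at each of the six branch points is a reflection. -/
theorem exists_inv_mul_eq_sr (hB : D.IsBranchedAt B) {C : DihedralCovering B}
    (c : Cutting D C.1 G) (k : Fin 6) : ∃ i, (G k)⁻¹ * G (k + 1) = .sr i := by
  have h1 := c.inv_mul_ne_one hB k
  refine dihedral_eq_sr_of_mul_self h1 ?_
  have h2 := c.act_vertex k
  rcases c.eq_one_or_eq_of_act_vertex hB k h1 h2 (c.act_inv_eq.2 h2.symm) with h | h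
  · exact absurd (inv_eq_one.1 h) h1
  · rw [← inv_eq_iff_mul_eq_one]
    exact h

theorem exists_gluing (hB : D.IsBranchedAt B) (C : DihedralCovering B) :
    ∃ v, Nonempty (Cutting D C.1 (gluing v)) := by
  obtain ⟨G₀, ⟨c₀⟩⟩ := exists_cutting hB C
  obtain ⟨c⟩ := c₀.nonempty_mul (G₀ 0)⁻¹
  set G := fun k => (G₀ 0)⁻¹ * G₀ k with hG
  have g0 : G 0 = 1 := inv_mul_cancel _
  have step : ∀ k, ∃ i, G (k + 1) = G k * .sr i := fun k => by
    obtain ⟨i, hi⟩ := c.exists_inv_mul_eq_sr hB k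
    exact ⟨i, by rw [← hi, mul_inv_cancel_left]⟩
  obtain ⟨i1, (h1 : G 1 = G 0 * .sr i1)⟩ := step 0
  obtain ⟨i2, (h2 : G 2 = G 1 * .sr i2)⟩ := step 1
  obtain ⟨i3, (h3 : G 3 = G 2 * .sr i3)⟩ := step 2
  obtain ⟨i4, (h4 : G 4 = G 3 * .sr i4)⟩ := step 3
  obtain ⟨i5, (h5 : G 5 = G 4 * .sr i5)⟩ := step 4
  rw [g0, one_mul] at h1
  rw [h1, DihedralGroup.sr_mul_sr] at h2
  rw [h2, DihedralGroup.r_mul_sr] at h3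
  rw [h3, DihedralGroup.sr_mul_sr] at h4
  rw [h4, DihedralGroup.r_mul_sr] at h5
  -- conjugation by `r m` maps `sr a` to `sr (a - 2 * m)`, and `8 = 1` in `ZMod 7`
  obtain ⟨m, hm⟩ : ∃ m : ZMod 7, i3 - (i2 - i1) - m - m = 0 := by
    refine ⟨4 * (i3 - (i2 - i1)), ?_⟩
    generalize i3 - (i2 - i1) = a
    revert a; decide
  obtain ⟨c'⟩ := c.nonempty_map (MulAut.conj (DihedralGroup.r m))
  have key : ∃ v, (fun k => MulAut.conj (DihedralGroup.r m) (G k)) = gluing v := by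
    refine ⟨![i1 - m + -m, m + (i2 - i1) + -m, m + (i4 - (i3 - (i2 - i1))) + -m,
      i5 - (i4 - (i3 - (i2 - i1))) - m + -m], ?_⟩
    · funext k
      fin_cases k
      · simp only [Fin.zero_eta, g0, map_one]; rfl
      · change MulAut.conj _ (G 1) = .sr _
        rw [h1, MulAut.conj_apply, DihedralGroup.r_mul_sr, DihedralGroup.inv_r,
          DihedralGroup.sr_mul_r]
        rfl
      · change MulAut.conj _ (G 2) = .r _
        rw [h2, MulAut.conj_apply, DihedralGroup.r_mul_r, DihedralGroup.inv_r,
          DihedralGroup.r_mul_r]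
        rfl
      · change MulAut.conj _ (G 3) = .sr 0
        rw [h3, MulAut.conj_apply, DihedralGroup.r_mul_sr, DihedralGroup.inv_r,
          DihedralGroup.sr_mul_r, ← hm, ← sub_eq_add_neg]
      · change MulAut.conj _ (G 4) = .r _
        rw [h4, MulAut.conj_apply, DihedralGroup.r_mul_r, DihedralGroup.inv_r,
          DihedralGroup.r_mul_r]
        rfl
      · change MulAut.conj _ (G 5) = .sr _
        rw [h5, MulAut.conj_apply, DihedralGroup.r_mul_sr, DihedralGroup.inv_r,
          DihedralGroup.sr_mul_r]
        rfl
  obtain ⟨v, hv⟩ := key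
  exact ⟨v, ⟨hv ▸ c'⟩⟩

theorem nonempty_smul {C : SphereCovering} {v : Fin 4 → ZMod 7} (c : Cutting D C (gluing v))
    (u : (ZMod 7)ˣ) : Nonempty (Cutting D C (gluing ((u : ZMod 7) • v))) := by
  rw [← dihedralScale_gluing]
  exact c.nonempty_map (dihedralScale u)

/-- The normalised gluing elements of a covering are unique up to scaling. -/
theorem exists_smul_eq (hB : D.IsBranchedAt B) {C : DihedralCovering B} {v v' : Fin 4 → ZMod 7}
    (c : Cutting D C.1 (gluing v)) (c' : Cutting D C.1 (gluing v')) :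
    ∃ u : (ZMod 7)ˣ, (u : ZMod 7) • v = v' := by
  obtain ⟨β, a, b, h⟩ := c.exists_mulEquiv hB c'
  have h0 : β (a * 1 * b⁻¹) = 1 := (h 0).symm
  obtain rfl : a = b := by
    rw [mul_one, ← map_one β] at h0
    exact mul_inv_eq_one.1 (β.injective h0)
  have hβ : ∀ k, gluing v' k = ((MulAut.conj a).trans β) (gluing v k) := h
  obtain ⟨u, hu⟩ := exists_scale_of_fixes (β := (MulAut.conj a).trans β) (hβ 3).symm
  have e0 := (hβ 1).trans (hu _).2
  have e1 := (hβ 2).trans (hu _).1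
  have e2 := (hβ 4).trans (hu _).1
  have e3 := (hβ 5).trans (hu _).2
  refine ⟨u, funext fun k => ?_⟩
  fin_cases k
  · exact (DihedralGroup.sr.inj e0).symm
  · exact (DihedralGroup.r.inj e1).symm
  · exact (DihedralGroup.r.inj e2).symm
  · exact (DihedralGroup.sr.inj e3).symm

/-- Since the covering space is connected, the gluing elements generate the group. -/
theorem eq_top_of_forall_mem (hB : D.IsBranchedAt B) {C : DihedralCovering B}
    (c : Cutting D C.1 G) {H : Subgroup (DihedralGroup 7)} (hH : ∀ k, G k ∈ H) : H = ⊤ := by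
  have stab : ∀ {g : DihedralGroup 7} {ε : Bool} {w : Disc}, (ε = true ∨ ∀ k, w ≠ vertexPt k) →
      c.act g (c.sec ε w) = c.sec ε w → g ∈ H := by
    intro g ε w hεw h
    by_cases hw : ∃ k, w = vertexPt k
    · obtain ⟨k, rfl⟩ := hw
      obtain rfl : ε = true := hεw.resolve_right fun h => h k rfl
      rcases c.eq_one_or_eq_of_act_vertex hB k (c.inv_mul_ne_one hB k) (c.act_vertex k) h
        with rfl | rfl
      · exact H.one_mem
      · exact H.mul_mem (H.inv_mem (hH k)) (hH (k + 1))
    · rw [c.act_eq_self_of_notMem (by rw [c.f_sec, hB.hemi_mem]; exact hw) h]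
      exact H.one_mem
  have key : ∀ {g g' : DihedralGroup 7} {ε ε' : Bool} {w w' : Disc},
      c.act g (c.sec ε w) = c.act g' (c.sec ε' w') → g ∈ H → g' ∈ H := by
    intro g g' ε ε' w w' h hg
    have h1 : D.hemi ε w = D.hemi ε' w' := by
      rw [← c.f_sec ε w, ← c.f_sec ε' w', ← c.f_act g (c.sec ε w), h, c.f_act]
    obtain ⟨rfl, hε⟩ := (D.hemi_eq_iff _ _ _ _).1 h1
    by_cases hw : ‖(w : ℂ)‖ = 1
    · obtain ⟨k, hk⟩ := exists_mem_arc hw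
      have e : ∀ ε, ∃ x ∈ H, c.sec ε w = c.act x (c.sec true w) := by
        rintro (_ | _)
        · exact ⟨G k, hH k, c.glue k w hk⟩
        · exact ⟨1, H.one_mem, (c.act_one _).symm⟩
      obtain ⟨x, hx, ex⟩ := e ε
      obtain ⟨x', hx', ex'⟩ := e ε'
      rw [ex, ex', ← c.act_mul, ← c.act_mul, c.act_eq_act] at h
      have h2 := stab (Or.inl rfl) h
      rw [H.mul_mem_cancel_right (H.mul_mem hg hx), H.inv_mem_iff,
        H.mul_mem_cancel_right hx'] at h2
      exact h2
    · obtain rfl := hε.resolve_right hw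
      rw [c.act_eq_act] at h
      have h2 := stab (Or.inr fun k hk => hw (by rw [hk]; exact norm_vertex k)) h
      rwa [H.mul_mem_cancel_right hg, H.inv_mem_iff] at h2
  have hcl : ∀ S : Set (DihedralGroup 7),
      IsClosed (⋃ p ∈ S ×ˢ (univ : Set Bool), range fun w => c.act p.1 (c.sec p.2 w)) :=
    fun S => (toFinite _).isClosed_biUnion fun p _ =>
      (isCompact_range ((c.act p.1).continuous.comp (c.continuous_sec p.2))).isClosed
  have hmem : ∀ S : Set (DihedralGroup 7), ∀ z,
      (z ∈ ⋃ p ∈ S ×ˢ (univ : Set Bool), range fun w => c.act p.1 (c.sec p.2 w)) ↔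
        ∃ g ∈ S, ∃ ε w, c.act g (c.sec ε w) = z := by
    intro S z
    simp
  have hcompl : (⋃ p ∈ (H : Set (DihedralGroup 7)) ×ˢ (univ : Set Bool),
      range fun w => c.act p.1 (c.sec p.2 w))ᶜ =
      ⋃ p ∈ (H : Set (DihedralGroup 7))ᶜ ×ˢ (univ : Set Bool),
        range fun w => c.act p.1 (c.sec p.2 w) := by
    ext z
    rw [mem_compl_iff, hmem, hmem]
    constructor
    · intro h
      obtain ⟨g, ε, w, rfl⟩ := c.exists_eq_act_sec z
      exact ⟨g, fun hg => h ⟨g, hg, ε, w, rfl⟩, ε, w, rfl⟩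
    · rintro ⟨g, hg, ε, w, rfl⟩ ⟨g', hg', ε', w', h⟩
      exact hg (key h hg')
  have hclopen : IsClopen (⋃ p ∈ (H : Set (DihedralGroup 7)) ×ˢ (univ : Set Bool),
      range fun w => c.act p.1 (c.sec p.2 w)) :=
    ⟨hcl _, isClosed_compl_iff.1 (hcompl ▸ hcl _)⟩
  have huniv := hclopen.eq_univ ⟨c.act 1 (c.sec true discZero), (hmem _ _).2
    ⟨1, H.one_mem, true, discZero, rfl⟩⟩
  rw [eq_top_iff]
  intro g _
  obtain ⟨g', hg', ε, w, h⟩ := (hmem _ _).1 (huniv.ge (mem_univ (c.act g (c.sec true discZero))))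
  exact key h hg'

theorem gluing_ne_zero (hB : D.IsBranchedAt B) {C : DihedralCovering B} {v : Fin 4 → ZMod 7}
    (c : Cutting D C.1 (gluing v)) : v ≠ 0 := by
  rintro rfl
  have h := c.eq_top_of_forall_mem hB (H := Subgroup.zpowers (.sr 0)) (by
    intro k
    fin_cases k
    · exact Subgroup.one_mem _
    · exact Subgroup.mem_zpowers _
    · exact Subgroup.one_mem _
    · exact Subgroup.mem_zpowers _
    · exact Subgroup.one_mem _
    · exact Subgroup.mem_zpowers _)
  have h1 : Nat.card (Subgroup.zpowers (DihedralGroup.sr 0 : DihedralGroup 7)) = 2 := by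
    rw [Nat.card_zpowers, DihedralGroup.orderOf_sr]
  rw [h, Subgroup.card_top, DihedralGroup.nat_card] at h1
  norm_num at h1

end Cutting

/-- If all nonzero vectors occur as gluing data, the coverings are classified by a projective
space. -/
theorem nonempty_equiv_projectivization {D : DiscDouble (OnePoint ℂ)} {B : Finset (OnePoint ℂ)}
    (hB : D.IsBranchedAt B) (hex : ∀ v : Fin 4 → ZMod 7, v ≠ 0 →
      ∃ C : DihedralCovering B, Nonempty (Cutting D C.1 (gluing v))) :
    Nonempty (Quotient (dihedralCoveringSetoid B) ≃ ℙ (ZMod 7) (Fin 4 → ZMod 7)) := by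
  choose V hV using Cutting.exists_gluing (D := D) hB
  have hV0 : ∀ C, V C ≠ 0 := fun C => (hV C).some.gluing_ne_zero hB
  have hiff : ∀ C C' : DihedralCovering B, C.1.Isomorphic C'.1 ↔
      Projectivization.mk (ZMod 7) (V C) (hV0 C) =
        Projectivization.mk (ZMod 7) (V C') (hV0 C') := by
    intro C C'
    rw [Projectivization.mk_eq_mk_iff]
    obtain ⟨c⟩ := hV C
    obtain ⟨c'⟩ := hV C'
    constructor
    · intro h
      obtain ⟨c''⟩ := c.nonempty_of_isomorphic h
      obtain ⟨u, hu⟩ := c'.exists_smul_eq hB c''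
      exact ⟨u, hu⟩
    · rintro ⟨u, hu⟩
      have hu' : (u : ZMod 7) • V C' = V C := hu
      obtain ⟨c''⟩ := c'.nonempty_smul u
      rw [hu'] at c''
      exact c.isomorphic hB c''
  refine ⟨Equiv.ofBijective (Quotient.lift
    (fun C => Projectivization.mk (ZMod 7) (V C) (hV0 C)) fun C C' h => (hiff C C').1 h) ⟨?_, ?_⟩⟩
  · rintro ⟨C⟩ ⟨C'⟩ h
    exact Quotient.sound ((hiff C C').2 h)
  · intro p
    induction p using Projectivization.ind with
    | h v hv =>
      obtain ⟨C, ⟨c⟩⟩ := hex v hv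
      obtain ⟨c'⟩ := hV C
      obtain ⟨u, hu⟩ := c.exists_smul_eq hB c'
      exact ⟨Quotient.mk _ C, (Projectivization.mk_eq_mk_iff _ _ _ _ _).2 ⟨u, hu⟩⟩

/-! ### Moving six points of the sphere -/

/-- The unit sphere in three-dimensional space. -/
abbrev Sph : Type := Metric.sphere (0 : EuclideanSpace ℝ (Fin 3)) 1

theorem Sph.exists_homeomorph_infty (p : Sph) :
    ∃ h : Sph ≃ₜ OnePoint ℂ, h p = OnePoint.infty := by
  have hp : ‖(p : EuclideanSpace ℝ (Fin 3))‖ = 1 := by simp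
  have hp0 : (p : EuclideanSpace ℝ (Fin 3)) ≠ 0 := by
    intro h; simp [h] at hp
  have : Fact (Module.finrank ℝ (EuclideanSpace ℝ (Fin 3)) = 2 + 1) := ⟨by simp⟩
  have hfin : Module.finrank ℝ (ℝ ∙ (p : EuclideanSpace ℝ (Fin 3)))ᗮ = Module.finrank ℝ ℂ := by
    rw [Submodule.finrank_orthogonal_span_singleton (n := 2) hp0, Complex.finrank_real_complex]
  obtain ⟨e⟩ := FiniteDimensional.nonempty_continuousLinearEquiv_of_finrank_eq hfin
  refine ⟨(onePointHyperplaneHomeoUnitSphere hp).symm.trans e.toHomeomorph.onePointCongr, ?_⟩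
  have h1 : onePointHyperplaneHomeoUnitSphere hp OnePoint.infty = p :=
    OnePoint.equivOfIsEmbeddingOfRangeEq_apply_infty ..
  have h2 : (onePointHyperplaneHomeoUnitSphere hp).symm p = OnePoint.infty := by
    rw [Homeomorph.symm_apply_eq, h1]
  rw [Homeomorph.trans_apply, h2]
  rfl

/-- The shear of the plane along the imaginary axis by a function of the real part. -/
noncomputable def shearIm (g : ℝ → ℝ) (hg : Continuous g) : ℂ ≃ₜ ℂ where
  toFun z := z + g z.re * Complex.I
  invFun z := z - g z.re * Complex.I
  left_inv z := by simp
  right_inv z := by simp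
  continuous_toFun := by fun_prop
  continuous_invFun := by fun_prop

/-- The shear of the plane along the real axis by a function of the imaginary part. -/
noncomputable def shearRe (g : ℝ → ℝ) (hg : Continuous g) : ℂ ≃ₜ ℂ where
  toFun z := z + g z.im
  invFun z := z - g z.im
  left_inv z := by simp
  right_inv z := by simp
  continuous_toFun := by fun_prop
  continuous_invFun := by fun_prop

theorem exists_continuous_interpolation {n : ℕ} {x : Fin n → ℝ} (hx : Function.Injective x)
    (y : Fin n → ℝ) : ∃ g : ℝ → ℝ, Continuous g ∧ ∀ k, g (x k) = y k :=
  ⟨fun t => (Lagrange.interpolate Finset.univ x y).eval t, Polynomial.continuous _, fun k =>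
    Lagrange.eval_interpolate_at_node _ hx.injOn (Finset.mem_univ k)⟩

/-- Finitely many points of the plane can be moved to the first natural numbers by shears: a linear
shear makes the real parts distinct, and interpolating shears do the rest. -/
theorem exists_homeomorph_natCast {n : ℕ} {p : Fin n → ℂ} (hp : Function.Injective p) :
    ∃ H : ℂ ≃ₜ ℂ, ∀ k, H (p k) = ((k : ℕ) : ℂ) := by
  obtain ⟨t, ht⟩ : ∃ t : ℝ, Function.Injective fun k => (p k).re + t * (p k).im := by
    have hfin : (⋃ ij ∈ {ij : Fin n × Fin n | ij.1 ≠ ij.2},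
        {t : ℝ | (p ij.1).re + t * (p ij.1).im = (p ij.2).re + t * (p ij.2).im}).Finite := by
      refine (toFinite _).biUnion fun ij hij => Set.Subsingleton.finite fun s hs t ht => ?_
      have hs' : (p ij.1).re + s * (p ij.1).im = (p ij.2).re + s * (p ij.2).im := hs
      have ht' : (p ij.1).re + t * (p ij.1).im = (p ij.2).re + t * (p ij.2).im := ht
      by_contra hst
      have h1 : (s - t) * ((p ij.1).im - (p ij.2).im) = 0 := by linarith
      have h2 : (p ij.1).im = (p ij.2).im :=
        sub_eq_zero.1 ((mul_eq_zero.1 h1).resolve_left (sub_ne_zero.2 hst))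
      have h3 : (p ij.1).re = (p ij.2).re := by rw [h2] at hs'; linarith
      exact hij (hp (Complex.ext h3 h2))
    obtain ⟨t, ht⟩ := hfin.infinite_compl.nonempty
    refine ⟨t, fun i j hij => ?_⟩
    by_contra hne
    exact ht (mem_biUnion (x := (i, j)) hne hij)
  have hk : Function.Injective fun k : Fin n => ((k : ℕ) : ℝ) := fun i j h =>
    Fin.ext (Nat.cast_injective (R := ℝ) h)
  obtain ⟨g₁, hg₁, e₁⟩ := exists_continuous_interpolation ht fun k => ((k : ℕ) : ℝ) - (p k).im
  obtain ⟨g₂, hg₂, e₂⟩ := exists_continuous_interpolation hk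
    fun k => ((k : ℕ) : ℝ) - ((p k).re + t * (p k).im)
  obtain ⟨g₃, hg₃, e₃⟩ := exists_continuous_interpolation hk fun k => -((k : ℕ) : ℝ)
  refine ⟨(((shearRe (fun y => t * y) (by fun_prop)).trans (shearIm g₁ hg₁)).trans
    (shearRe g₂ hg₂)).trans (shearIm g₃ hg₃), fun k => ?_⟩
  have s₁ : shearRe (fun y => t * y) (by fun_prop) (p k) =
      ⟨(p k).re + t * (p k).im, (p k).im⟩ := by
    apply Complex.ext <;> simp [shearRe]
  have s₂ : shearIm g₁ hg₁ ⟨(p k).re + t * (p k).im, (p k).im⟩ =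
      ⟨(p k).re + t * (p k).im, ((k : ℕ) : ℝ)⟩ := by
    apply Complex.ext <;> simp [shearIm, e₁]
  have s₃ : shearRe g₂ hg₂ ⟨(p k).re + t * (p k).im, ((k : ℕ) : ℝ)⟩ =
      ⟨((k : ℕ) : ℝ), ((k : ℕ) : ℝ)⟩ := by
    apply Complex.ext <;> simp [shearRe, e₂]
  have s₄ : shearIm g₃ hg₃ ⟨((k : ℕ) : ℝ), ((k : ℕ) : ℝ)⟩ = ((k : ℕ) : ℂ) := by
    apply Complex.ext <;> simp [shearIm, e₃]
  simp only [Homeomorph.trans_apply]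
  rw [s₁, s₂, s₃, s₄]

/-- Any finite sequence of distinct points of the unit sphere is matched with any such sequence in
the Riemann sphere by a homeomorphism. -/
theorem Sph.exists_homeomorph {n : ℕ} {a : Fin n → Sph} (ha : Function.Injective a)
    {b : Fin n → OnePoint ℂ} (hb : Function.Injective b) :
    ∃ H : Sph ≃ₜ OnePoint ℂ, ∀ k, H (a k) = b k := by
  have hinf : Infinite Sph := by
    obtain ⟨h, -⟩ := Sph.exists_homeomorph_infty ⟨EuclideanSpace.single 0 1, by simp⟩
    exact Infinite.of_injective _ (h.symm.injective.comp (OnePoint.coe_injective (X := ℂ)))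
  -- a chart of the sphere, minus a point, that contains all given points
  have key : ∀ c : Fin n → Sph, Function.Injective c → ∃ h : Sph ≃ₜ OnePoint ℂ,
      ∃ c' : Fin n → ℂ, Function.Injective c' ∧ ∀ k, h (c k) = c' k := by
    intro c hc
    obtain ⟨p, hp⟩ := (finite_range c).infinite_compl.nonempty
    obtain ⟨h, hh⟩ := Sph.exists_homeomorph_infty p
    have : ∀ k, ∃ z : ℂ, (z : OnePoint ℂ) = h (c k) := fun k => by
      refine OnePoint.ne_infty_iff_exists.1 fun hk => hp ⟨k, h.injective (hk.trans hh.symm)⟩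
    choose c' hc' using this
    refine ⟨h, c', fun i j hij => hc (h.injective ?_), fun k => (hc' k).symm⟩
    rw [← hc', ← hc', hij]
  obtain ⟨h₀, -⟩ := Sph.exists_homeomorph_infty ⟨EuclideanSpace.single 0 1, by simp⟩
  obtain ⟨h₁, a', ha', e₁⟩ := key a ha
  obtain ⟨h₂, b', hb', e₂⟩ := key (fun k => h₀.symm (b k)) (h₀.symm.injective.comp hb)
  obtain ⟨G₁, hG₁⟩ := exists_homeomorph_natCast ha'
  obtain ⟨G₂, hG₂⟩ := exists_homeomorph_natCast hb'
  refine ⟨((h₁.trans (G₁.trans G₂.symm).onePointCongr).trans h₂.symm).trans h₀, fun k => ?_⟩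
  have h3 : (G₁.trans G₂.symm).onePointCongr (a' k : OnePoint ℂ) = b' k := by
    change (((G₁.trans G₂.symm) (a' k) : ℂ) : OnePoint ℂ) = b' k
    rw [Homeomorph.trans_apply, hG₁, ← hG₂, Homeomorph.symm_apply_apply]
  simp only [Homeomorph.trans_apply]
  rw [e₁, h3, ← e₂, Homeomorph.symm_apply_apply, Homeomorph.apply_symm_apply]

/-! ### Coverings defined by extracting roots -/

/-- The space of pairs of a point `x` and an `n`-th root of `P x`. -/
abbrev RootCover {X : Type*} (P : X → ℂ) (n : ℕ) : Type _ := {q : X × ℂ // q.2 ^ n = P q.1}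

theorem HasStrictDerivAt.exists_openPartialHomeomorph {𝕜 : Type*} [RCLike 𝕜] {f : 𝕜 → 𝕜}
    {f' a : 𝕜} (h : HasStrictDerivAt f f' a) (hf' : f' ≠ 0) :
    ∃ e : OpenPartialHomeomorph 𝕜 𝕜, a ∈ e.source ∧ ⇑e = f :=
  ⟨(h.hasStrictFDerivAt_equiv hf').toOpenPartialHomeomorph f,
    HasStrictFDerivAt.mem_toOpenPartialHomeomorph_source _,
    HasStrictFDerivAt.toOpenPartialHomeomorph_coe _⟩

namespace RootCover

variable {X : Type*} [TopologicalSpace X] {P : X → ℂ} {n : ℕ}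

theorem compactSpace [CompactSpace X] (hP : Continuous P) (hn : n ≠ 0) :
    CompactSpace (RootCover P n) := by
  obtain ⟨M, hM⟩ := (isCompact_range hP).isBounded.exists_norm_le
  have hcl : IsClosed {q : X × ℂ | q.2 ^ n = P q.1} :=
    isClosed_eq (by fun_prop) (by fun_prop)
  have hsub : {q : X × ℂ | q.2 ^ n = P q.1} ⊆ univ ×ˢ Metric.closedBall 0 (max 1 M) := by
    intro q hq
    refine ⟨mem_univ _, ?_⟩
    rw [mem_closedBall_zero_iff]
    by_contra hcon
    push Not at hcon
    obtain ⟨h1, h2⟩ := max_lt_iff.1 hcon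
    have h3 : ‖q.2‖ ^ n ≤ M := by
      rw [← norm_pow, show q.2 ^ n = P q.1 from hq]
      exact hM _ ⟨_, rfl⟩
    have h4 := le_self_pow₀ h1.le hn
    linarith
  exact isCompact_iff_compactSpace.1
    ((isCompact_univ.prod (isCompact_closedBall _ _)).of_isClosed_subset hcl hsub)

/-- Away from the zeros of `P`, the projection is a local homeomorphism. -/
theorem exists_localHomeomorph (hP : Continuous P) (hn : n ≠ 0) (q : RootCover P n)
    (hq : q.1.2 ≠ 0) :
    ∃ e : OpenPartialHomeomorph (RootCover P n) X, q ∈ e.source ∧ ∀ r, e r = r.1.1 := by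
  classical
  obtain ⟨p, hp, hpn⟩ := (hasStrictDerivAt_pow n q.1.2).exists_openPartialHomeomorph
    (mul_ne_zero (by exact_mod_cast hn) (pow_ne_zero _ hq))
  have hpn' : ∀ y, p y = y ^ n := fun y => congrFun hpn y
  have hroot : ∀ x, P x ∈ p.target → (p.symm (P x)) ^ n = P x := fun x hx => by
    rw [← hpn', p.right_inv hx]
  refine ⟨
    { toFun := fun r => r.1.1
      invFun := fun x => if h : (p.symm (P x)) ^ n = P x then ⟨(x, p.symm (P x)), h⟩ else q
      source := {r | r.1.2 ∈ p.source}
      target := {x | P x ∈ p.target}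
      map_source' := fun r hr => ?_
      map_target' := fun x hx => ?_
      left_inv' := fun r hr => ?_
      right_inv' := fun x hx => ?_
      continuousOn_toFun := by fun_prop
      continuousOn_invFun := ?_
      open_source := p.open_source.preimage (by fun_prop)
      open_target := p.open_target.preimage hP }, hp, fun r => rfl⟩
  · have h := p.map_source hr
    rw [hpn', r.2] at h
    exact h
  · rw [dif_pos (hroot x hx)]
    exact p.map_target hx
  · have h1 : p.symm (P r.1.1) = r.1.2 := by rw [← r.2, ← hpn', p.left_inv hr]
    have h2 : (p.symm (P r.1.1)) ^ n = P r.1.1 := by rw [h1, r.2]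
    rw [dif_pos h2]
    exact Subtype.ext (Prod.ext rfl h1)
  · rw [dif_pos (hroot x hx)]
  · rw [(IsInducing.mk rfl : IsInducing (Subtype.val : RootCover P n → X × ℂ)).continuousOn_iff]
    have h1 : ContinuousOn (fun x => (x, p.symm (P x))) {x | P x ∈ p.target} :=
      continuousOn_id.prodMk (p.symm.continuousOn.comp hP.continuousOn fun x hx => hx)
    refine h1.congr fun x hx => ?_
    simp only [Function.comp_apply]
    rw [dif_pos (hroot x hx)]

/-- At a point where `P` is a local coordinate, the root is a local coordinate. -/
theorem exists_localHomeomorph_root (q : RootCover P n)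
    (ψ : OpenPartialHomeomorph X ℂ) (hψ : q.1.1 ∈ ψ.source) (hψP : ∀ x ∈ ψ.source, ψ x = P x) :
    ∃ e : OpenPartialHomeomorph (RootCover P n) ℂ, q ∈ e.source ∧ (∀ r, e r = r.1.2) ∧
      ∀ r ∈ e.source, r.1.1 ∈ ψ.source := by
  classical
  have hroot : ∀ y, y ^ n ∈ ψ.target → y ^ n = P (ψ.symm (y ^ n)) := fun y hy => by
    rw [← hψP _ (ψ.map_target hy), ψ.right_inv hy]
  refine ⟨
    { toFun := fun r => r.1.2
      invFun := fun y => if h : y ^ n = P (ψ.symm (y ^ n)) then ⟨(ψ.symm (y ^ n), y), h⟩ else q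
      source := {r | r.1.1 ∈ ψ.source}
      target := {y | y ^ n ∈ ψ.target}
      map_source' := fun r hr => ?_
      map_target' := fun y hy => ?_
      left_inv' := fun r hr => ?_
      right_inv' := fun y hy => ?_
      continuousOn_toFun := by fun_prop
      continuousOn_invFun := ?_
      open_source := ψ.open_source.preimage (by fun_prop)
      open_target := ψ.open_target.preimage (by fun_prop) }, hψ, fun r => rfl, fun r hr => hr⟩
  · have h := ψ.map_source hr
    rw [hψP _ hr, ← r.2] at h
    exact h
  · rw [dif_pos (hroot y hy)]
    exact ψ.map_target hy
  · have h1 : ψ.symm (r.1.2 ^ n) = r.1.1 := by rw [r.2, ← hψP _ hr, ψ.left_inv hr]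
    have h2 : r.1.2 ^ n = P (ψ.symm (r.1.2 ^ n)) := by rw [h1, r.2]
    rw [dif_pos h2]
    exact Subtype.ext (Prod.ext h1 rfl)
  · rw [dif_pos (hroot y hy)]
  · rw [(IsInducing.mk rfl : IsInducing (Subtype.val : RootCover P n → X × ℂ)).continuousOn_iff]
    have h1 : ContinuousOn (fun y : ℂ => (ψ.symm (y ^ n), y)) {y | y ^ n ∈ ψ.target} :=
      (ψ.symm.continuousOn.comp (f := fun y : ℂ => y ^ n) (continuous_pow n).continuousOn
        fun x hx => hx).prodMk continuousOn_id
    refine h1.congr fun y hy => ?_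
    simp only [Function.comp_apply]
    rw [dif_pos (hroot y hy)]

end RootCover

/-! ### Coordinates on the sphere -/

namespace Sph

theorem sq_add (p : Sph) : p.1 0 ^ 2 + p.1 1 ^ 2 + p.1 2 ^ 2 = 1 := by
  have h : ‖p.1‖ ^ 2 = 1 := by rw [norm_eq_of_mem_sphere, one_pow]
  rw [EuclideanSpace.norm_sq_eq, Fin.sum_univ_three] at h
  simpa using h

/-- The point of the sphere with given coordinates. -/
noncomputable def mk (x y t : ℝ) (h : x ^ 2 + y ^ 2 + t ^ 2 = 1) : Sph :=
  ⟨!₂[x, y, t], by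
    rw [mem_sphere_zero_iff_norm, EuclideanSpace.norm_eq, Fin.sum_univ_three]
    simp [h]⟩

@[ext]
theorem ext {p q : Sph} (h0 : p.1 0 = q.1 0) (h1 : p.1 1 = q.1 1) (h2 : p.1 2 = q.1 2) :
    p = q := by
  refine Subtype.ext (PiLp.ext fun i => ?_)
  fin_cases i
  exacts [h0, h1, h2]

@[simp] theorem mk_one {x y t : ℝ} (h : x ^ 2 + y ^ 2 + t ^ 2 = 1) : (mk x y t h).1 1 = y := rfl
@[simp] theorem mk_two {x y t : ℝ} (h : x ^ 2 + y ^ 2 + t ^ 2 = 1) : (mk x y t h).1 2 = t := rfl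

theorem continuous_mk {X : Type*} [TopologicalSpace X] {x y t : X → ℝ} (hx : Continuous x)
    (hy : Continuous y) (ht : Continuous t) (h : ∀ a, x a ^ 2 + y a ^ 2 + t a ^ 2 = 1) :
    Continuous fun a => mk (x a) (y a) (t a) (h a) := by
  refine Continuous.subtype_mk ?_ _
  refine (PiLp.continuous_toLp 2 _).comp (continuous_pi fun i => ?_)
  fin_cases i
  exacts [hx, hy, ht]

@[fun_prop]
theorem continuous_coord (i : Fin 3) : Continuous fun p : Sph => p.1 i := by fun_prop

/-- The sign `1` for the upper and `-1` for the lower hemisphere. -/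
def side (ε : Bool) : ℝ := bif ε then 1 else -1

theorem side_sq (ε : Bool) : side ε ^ 2 = 1 := by cases ε <;> simp [side]

theorem normSq_le_one (w : Disc) : (w : ℂ).re ^ 2 + (w : ℂ).im ^ 2 ≤ 1 := by
  have h := w.2
  rw [mem_closedBall_zero_iff, ← sq_le_sq₀ (norm_nonneg _) zero_le_one, Complex.sq_norm,
    Complex.normSq_apply] at h
  nlinarith

/-- The sphere as the double of the disc. -/
noncomputable def discDouble : DiscDouble Sph where
  hemi ε w := mk (w : ℂ).re (w : ℂ).im (side ε * √(1 - ((w : ℂ).re ^ 2 + (w : ℂ).im ^ 2))) (by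
    rw [mul_pow, side_sq, Real.sq_sqrt (sub_nonneg.2 (normSq_le_one w))]; ring)
  continuous_hemi ε := by
    apply continuous_mk <;> fun_prop
  hemi_eq_iff ε ε' w w' := by
    constructor
    · intro h
      have h0 : (w : ℂ).re = (w' : ℂ).re := congrArg (fun p : Sph => p.1 0) h
      have h1 : (w : ℂ).im = (w' : ℂ).im := congrArg (fun p : Sph => p.1 1) h
      have h2 : side ε * √(1 - ((w : ℂ).re ^ 2 + (w : ℂ).im ^ 2)) =
        side ε' * √(1 - ((w' : ℂ).re ^ 2 + (w' : ℂ).im ^ 2)) := congrArg (fun p : Sph => p.1 2) h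
      refine ⟨Subtype.ext (Complex.ext h0 h1), ?_⟩
      rw [← h0, ← h1] at h2
      by_cases hε : ε = ε'
      · exact Or.inl hε
      · right
        have h3 : √(1 - ((w : ℂ).re ^ 2 + (w : ℂ).im ^ 2)) = 0 := by
          cases ε <;> cases ε' <;> simp [side] at hε h2 ⊢ <;> linarith
        rw [Real.sqrt_eq_zero (sub_nonneg.2 (normSq_le_one w))] at h3
        rw [norm_eq_one_iff_sq]; linarith
    · rintro ⟨rfl, rfl | h⟩
      · rfl
      · rw [norm_eq_one_iff_sq] at h
        ext <;> simp [h]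
  exists_hemi p := by
    have h := p.sq_add
    have hn : ‖(⟨p.1 0, p.1 1⟩ : ℂ)‖ ≤ 1 := by
      rw [← sq_le_sq₀ (norm_nonneg _) zero_le_one, Complex.sq_norm, Complex.normSq_apply]
      nlinarith [sq_nonneg (p.1 2)]
    have e : 1 - (p.1 0 ^ 2 + p.1 1 ^ 2) = p.1 2 ^ 2 := by linarith
    rcases le_total 0 (p.1 2) with h2 | h2
    · refine ⟨true, ⟨⟨p.1 0, p.1 1⟩, by simpa using hn⟩, ?_⟩
      ext
      · rfl
      · rfl
      · simp [side, e, Real.sqrt_sq_eq_abs, abs_of_nonneg h2]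
    · refine ⟨false, ⟨⟨p.1 0, p.1 1⟩, by simpa using hn⟩, ?_⟩
      ext
      · rfl
      · rfl
      · simp [side, e, Real.sqrt_sq_eq_abs, abs_of_nonpos h2]

/-- A centred chart at a point of the sphere. -/
theorem exists_chart (p : Sph) : ∃ ψ : OpenPartialHomeomorph Sph ℂ, p ∈ ψ.source ∧ ψ p = 0 := by
  have : Fact (Module.finrank ℝ (EuclideanSpace ℝ (Fin 3)) = 2 + 1) := ⟨by simp⟩
  let e := (chartAt (EuclideanSpace ℝ (Fin 2)) p).trans
    (Complex.orthonormalBasisOneI.repr.symm.toHomeomorph.toOpenPartialHomeomorph)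
  refine ⟨e.trans (Homeomorph.subRight (e p)).toOpenPartialHomeomorph, ?_, ?_⟩
  · simp [e]
  · simp

/-- The cubic in the first coordinate whose zeros on the equator are the six vertices. -/
noncomputable def cubic (x : ℝ) : ℝ := x * (4 * x ^ 2 - 1)

/-- A function on the sphere with simple zeros at the six vertices: on the equator it is real, and
its sign alternates from arc to arc; off the equator its imaginary part distinguishes the two
hemispheres. -/
noncomputable def radicand (p : Sph) : ℂ := ⟨cubic (p.1 0), p.1 2⟩

theorem continuous_radicand : Continuous radicand :=
  Complex.equivRealProdCLM.symm.continuous.comp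
    ((by unfold cubic; fun_prop : Continuous fun p : Sph => cubic (p.1 0)).prodMk
      (continuous_coord 2))

theorem cubic_eq_zero_iff {x : ℝ} : cubic x = 0 ↔ x = 0 ∨ x = 1 / 2 ∨ x = -(1 / 2) := by
  have : cubic x = x * ((2 * x - 1) * (2 * x + 1)) := by unfold cubic; ring
  rw [this, mul_eq_zero, mul_eq_zero]
  constructor
  · rintro (h | h | h)
    · exact Or.inl h
    · exact Or.inr (Or.inl (by linarith))
    · exact Or.inr (Or.inr (by linarith))
  · rintro (rfl | rfl | rfl) <;> norm_num

/-- The zeros of `radicand` are simple, so that it is a local coordinate there. -/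
theorem exists_chart_radicand {p : Sph} (hp : radicand p = 0) :
    ∃ ψ : OpenPartialHomeomorph Sph ℂ, p ∈ ψ.source ∧ ∀ q ∈ ψ.source, ψ q = radicand q := by
  have h0 : cubic (p.1 0) = 0 := congrArg Complex.re hp
  have h2 : p.1 2 = 0 := congrArg Complex.im hp
  have hsq := p.sq_add
  have hp1 : p.1 1 ≠ 0 := by
    intro h1
    rw [h1, h2] at hsq
    rcases cubic_eq_zero_iff.1 h0 with h | h | h <;> rw [h] at hsq <;> norm_num at hsq
  obtain ⟨s, hs, hsp⟩ : ∃ s : ℝ, s ^ 2 = 1 ∧ 0 < s * p.1 1 := by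
    rcases lt_or_gt_of_ne hp1 with h | h
    · exact ⟨-1, by norm_num, by linarith⟩
    · exact ⟨1, by norm_num, by linarith⟩
  -- the half sphere around `p` as a graph over the first and the third coordinate
  let g : OpenPartialHomeomorph Sph (ℝ × ℝ) :=
    { toFun := fun q => (q.1 0, q.1 2)
      invFun := fun a => if h : a.1 ^ 2 + a.2 ^ 2 < 1 then
        mk a.1 (s * √(1 - (a.1 ^ 2 + a.2 ^ 2))) a.2 (by
          rw [mul_pow, hs, Real.sq_sqrt (by linarith)]; ring) else p
      source := {q | 0 < s * q.1 1}
      target := {a | a.1 ^ 2 + a.2 ^ 2 < 1}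
      map_source' := fun q (hq : 0 < s * q.1 1) => by
        have h1 := q.sq_add
        have h3 : (s * q.1 1) ^ 2 = q.1 1 ^ 2 := by rw [mul_pow, hs, one_mul]
        change q.1 0 ^ 2 + q.1 2 ^ 2 < 1
        nlinarith
      map_target' := fun a (ha : a.1 ^ 2 + a.2 ^ 2 < 1) => by
        rw [dif_pos ha]
        change 0 < s * (s * √(1 - (a.1 ^ 2 + a.2 ^ 2)))
        rw [← mul_assoc, ← sq, hs, one_mul]
        exact Real.sqrt_pos.2 (by linarith)
      left_inv' := fun q (hq : 0 < s * q.1 1) => by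
        have h1 := q.sq_add
        have h3 : (s * q.1 1) ^ 2 = q.1 1 ^ 2 := by rw [mul_pow, hs, one_mul]
        have h4 : q.1 0 ^ 2 + q.1 2 ^ 2 < 1 := by nlinarith
        simp only
        rw [dif_pos h4]
        ext
        · rfl
        · have h5 : 1 - (q.1 0 ^ 2 + q.1 2 ^ 2) = (s * q.1 1) ^ 2 := by linarith
          rw [mk_one, h5, Real.sqrt_sq hq.le, ← mul_assoc, ← sq, hs, one_mul]
        · rfl
      right_inv' := fun a (ha : a.1 ^ 2 + a.2 ^ 2 < 1) => by
        simp only [dif_pos ha]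
        rfl
      continuousOn_toFun := by fun_prop
      continuousOn_invFun := by
        rw [continuousOn_iff_continuous_domRestrict]
        have : Continuous fun a : {a : ℝ × ℝ | a.1 ^ 2 + a.2 ^ 2 < 1} =>
            mk a.1.1 (s * √(1 - (a.1.1 ^ 2 + a.1.2 ^ 2))) a.1.2 (by
              have : a.1.1 ^ 2 + a.1.2 ^ 2 < 1 := a.2
              rw [mul_pow, hs, Real.sq_sqrt (by linarith)]; ring) := by
          apply continuous_mk <;> fun_prop
        exact this.congr fun a => by
          simp only [Set.domRestrict_apply]
          rw [dif_pos (show a.1.1 ^ 2 + a.1.2 ^ 2 < 1 from a.2)]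
      open_source := isOpen_lt continuous_const (by fun_prop)
      open_target := isOpen_lt (by fun_prop) continuous_const }
  have hder : HasStrictDerivAt cubic (12 * p.1 0 ^ 2 - 1) (p.1 0) := by
    have h := (hasStrictDerivAt_id (p.1 0)).mul
      ((((hasStrictDerivAt_id (p.1 0)).pow 2).const_mul 4).sub_const 1)
    convert! h using 1
    simp; ring
  obtain ⟨e, he, hec⟩ := hder.exists_openPartialHomeomorph (by
    rcases cubic_eq_zero_iff.1 h0 with h | h | h <;> rw [h] <;> norm_num)
  refine ⟨(g.trans (e.prod (OpenPartialHomeomorph.refl ℝ))).trans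
    Complex.equivRealProdCLM.symm.toHomeomorph.toOpenPartialHomeomorph, ?_, ?_⟩
  · simpa [g] using ⟨hsp, he⟩
  · intro q _
    change (⟨e (q.1 0), q.1 2⟩ : ℂ) = radicand q
    rw [hec]
    rfl

theorem radicand_eq_zero_iff {ε : Bool} {w : Disc} :
    radicand (discDouble.hemi ε w) = 0 ↔ ∃ k, w = vertexPt k := by
  constructor
  · intro h
    have h0 : cubic (w : ℂ).re = 0 := congrArg Complex.re h
    have h2 : side ε * √(1 - ((w : ℂ).re ^ 2 + (w : ℂ).im ^ 2)) = 0 := congrArg Complex.im h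
    have hs : side ε ≠ 0 := by cases ε <;> simp [side]
    have h3 := (mul_eq_zero.1 h2).resolve_left hs
    rw [Real.sqrt_eq_zero (sub_nonneg.2 (normSq_le_one w))] at h3
    have h4 := sqrt_three_half_sq
    have key : ∀ k, (w : ℂ).re = (vertex k).re → (w : ℂ).im = (vertex k).im → ∃ k, w = vertexPt k :=
      fun k hr hi => ⟨k, Subtype.ext (Complex.ext hr hi)⟩
    rcases cubic_eq_zero_iff.1 h0 with h | h | h <;> rw [h] at h3
    · rcases sq_eq_sq_iff_eq_or_eq_neg.1 (show (w : ℂ).im ^ 2 = 1 ^ 2 by linarith) with h5 | h5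
      · exact key 1 (by rw [h]; rfl) h5
      · exact key 4 (by rw [h]; rfl) h5
    · rcases sq_eq_sq_iff_eq_or_eq_neg.1 (show (w : ℂ).im ^ 2 = (√3 / 2) ^ 2 by linarith)
        with h5 | h5
      · exact key 0 (by rw [h]; rfl) h5
      · exact key 5 (by rw [h]; rfl) h5
    · rcases sq_eq_sq_iff_eq_or_eq_neg.1 (show (w : ℂ).im ^ 2 = (√3 / 2) ^ 2 by linarith)
        with h5 | h5
      · exact key 2 (by rw [h]; rfl) h5
      · exact key 3 (by rw [h]; rfl) h5
  · rintro ⟨k, rfl⟩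
    have h1 : (vertex k).re ^ 2 + (vertex k).im ^ 2 = 1 := norm_eq_one_iff_sq.1 (norm_vertex k)
    apply Complex.ext
    · change cubic (vertex k).re = 0
      rw [cubic_eq_zero_iff]
      exact (or_left_comm.1 (vertex_re k))
    · change side ε * √(1 - ((vertex k).re ^ 2 + (vertex k).im ^ 2)) = 0
      rw [h1]; simp

end Sph

/-! ### Circle-valued functions -/

/-- A function of a point `(x, y)` of the plane, constant on certain arcs of the unit circle: it is
`0` where `1 / 2 ≤ x`, and where `- 1 / 2 ≤ x ≤ 0` it is `a` for `0 ≤ y` and `b` for `y ≤ 0`. -/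
noncomputable def bump (a b x y : ℝ) : ℝ :=
  max 0 (min 1 (1 - 2 * x)) *
    ((1 + max (-1) (min 1 (2 * y))) / 2 * a + (1 - max (-1) (min 1 (2 * y))) / 2 * b)

theorem bump_right {a b x y : ℝ} (hx : 1 / 2 ≤ x) : bump a b x y = 0 := by
  have : min 1 (1 - 2 * x) ≤ 0 := (min_le_right _ _).trans (by linarith)
  rw [bump, max_eq_left this, zero_mul]

theorem bump_upper {a b x y : ℝ} (h : x ^ 2 + y ^ 2 = 1) (hx : -(1 / 2) ≤ x) (hx' : x ≤ 0)
    (hy : 0 ≤ y) : bump a b x y = a := by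
  have h1 : 1 ≤ 2 * y := by nlinarith
  rw [bump, min_eq_left (by linarith), min_eq_left h1]
  norm_num

theorem bump_lower {a b x y : ℝ} (h : x ^ 2 + y ^ 2 = 1) (hx : -(1 / 2) ≤ x) (hx' : x ≤ 0)
    (hy : y ≤ 0) : bump a b x y = b := by
  have h1 : 2 * y ≤ -1 := by nlinarith
  rw [bump, min_eq_left (by linarith), min_eq_right (by linarith), max_eq_left h1]
  norm_num

theorem exists_int_bump (a b : ℤ) {x y : ℝ} (h : x ^ 2 + y ^ 2 = 1) (hx : 0 ≤ Sph.cubic x) :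
    ∃ n : ℤ, bump a b x y = n := by
  by_cases h1 : 1 / 2 ≤ x
  · exact ⟨0, by rw [bump_right h1, Int.cast_zero]⟩
  have hc : Sph.cubic x = x * ((2 * x - 1) * (2 * x + 1)) := by unfold Sph.cubic; ring
  have h2 : x ≤ 0 ∧ -(1 / 2) ≤ x := by
    push Not at h1
    rw [hc] at hx
    constructor
    · by_contra h3
      push Not at h3
      have : 0 < x * ((1 - 2 * x) * (2 * x + 1)) := by
        have : 0 < 1 - 2 * x := by linarith
        positivity
      linarith
    · by_contra h3
      push Not at h3
      have : 0 < (-x) * ((1 - 2 * x) * (-(2 * x + 1))) :=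
        mul_pos (by linarith) (mul_pos (by linarith) (by linarith))
      linarith
  rcases le_total 0 y with hy | hy
  · exact ⟨a, bump_upper h h2.2 h2.1 hy⟩
  · exact ⟨b, bump_lower h h2.2 h2.1 hy⟩

/-- The complex number `exp (- i π s A)`, where `s` is the sign of `a`; for `a = 0` this notation
makes sense if `A` is an integer. -/
noncomputable def phase (a A : ℝ) : ℂ :=
  ⟨Real.cos (Real.pi * A), -(Real.sign a * Real.sin (Real.pi * A))⟩

theorem phase_neg (a A : ℝ) : phase (-a) A = conj (phase a A) := by
  apply Complex.ext <;> simp [phase, Real.sign_neg]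

theorem phase_eq_exp {a A s : ℝ} (hs : s ^ 2 = 1) (ha : 0 ≤ s * a)
    (h0 : a = 0 → Real.sin (Real.pi * A) = 0) :
    phase a A = Complex.exp ((-(Real.pi * s * A) : ℝ) * Complex.I) := by
  have hs' : s = 1 ∨ s = -1 := sq_eq_one_iff.1 hs
  apply Complex.ext
  · rw [Complex.exp_ofReal_mul_I_re, Real.cos_neg]
    rcases hs' with rfl | rfl
    · simp [phase]
    · rw [show Real.pi * -1 * A = -(Real.pi * A) by ring, Real.cos_neg]
      rfl
  · rw [Complex.exp_ofReal_mul_I_im, Real.sin_neg]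
    change -(Real.sign a * Real.sin (Real.pi * A)) = _
    rcases eq_or_ne a 0 with h | h
    · have h1 := h0 h
      rcases hs' with rfl | rfl <;> simp [h1]
    · rcases hs' with rfl | rfl
      · rw [Real.sign_of_pos (lt_of_le_of_ne (by linarith) h.symm)]; simp
      · rw [Real.sign_of_neg (lt_of_le_of_ne (by linarith) h)]; simp

theorem continuous_phase {X : Type*} [TopologicalSpace X] {g A : X → ℝ} (hg : Continuous g)
    (hA : Continuous A) (h0 : ∀ x, g x = 0 → Real.sin (Real.pi * A x) = 0) :
    Continuous fun x => phase (g x) (A x) := by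
  refine Complex.equivRealProdCLM.symm.continuous.comp
    ((by fun_prop : Continuous fun x => Real.cos (Real.pi * A x)).prodMk (Continuous.neg ?_))
  have hsin : Continuous fun x => Real.sin (Real.pi * A x) := by fun_prop
  rw [continuous_iff_continuousAt]
  intro x
  rcases lt_trichotomy (g x) 0 with h | h | h
  · refine (hsin.neg.continuousAt (x := x)).congr ?_
    filter_upwards [hg.continuousAt.eventually_lt continuousAt_const h] with y hy
    rw [Real.sign_of_neg hy, neg_one_mul]
    rfl
  · rw [ContinuousAt, h, Real.sign_zero, zero_mul]
    refine squeeze_zero_norm (a := fun y => |Real.sin (Real.pi * A y)|) (fun y => ?_) ?_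
    · rw [norm_mul, Real.norm_eq_abs, Real.norm_eq_abs]
      refine mul_le_of_le_one_left (abs_nonneg _) ?_
      rcases Real.sign_apply_eq (g y) with h | h | h <;> rw [h] <;> norm_num
    · have := (hsin.abs.tendsto x)
      rwa [h0 x h, abs_zero] at this
  · refine (hsin.continuousAt (x := x)).congr ?_
    filter_upwards [continuousAt_const.eventually_lt hg.continuousAt h] with y hy
    rw [Real.sign_of_pos hy, one_mul]

theorem stdAddChar_eq_one_iff {i : ZMod 7} : ZMod.stdAddChar i = 1 ↔ i = 0 := by
  rw [← ZMod.injective_stdAddChar.eq_iff (a := i) (b := 0), AddChar.map_zero_eq_one]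

theorem stdAddChar_pow_seven (i : ZMod 7) : ZMod.stdAddChar i ^ 7 = 1 := by
  rw [← AddChar.map_nsmul_eq_pow]
  have : 7 • i = 0 := by revert i; decide
  rw [this, AddChar.map_zero_eq_one]

theorem conj_stdAddChar (i : ZMod 7) : conj (ZMod.stdAddChar i) = ZMod.stdAddChar (-i) := by
  rw [AddChar.map_neg_eq_conj]

/-- The seventh roots of unity. -/
theorem exists_stdAddChar_eq {ζ : ℂ} (h : ζ ^ 7 = 1) : ∃ i : ZMod 7, ZMod.stdAddChar i = ζ := by
  obtain ⟨k, -, hk⟩ := (Complex.isPrimitiveRoot_exp 7 (by norm_num)).eq_pow_of_pow_eq_one h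
  refine ⟨((k : ℤ) : ZMod 7), ?_⟩
  rw [ZMod.stdAddChar_coe, ← hk, ← Complex.exp_nat_mul]
  congr 1
  push_cast
  ring

/-! ### A dihedral covering of the sphere -/

/-- The double covering of the sphere that is ramified at the six vertices, a curve of genus two. -/
abbrev DoubleCover : Type := RootCover Sph.radicand 2

namespace DoubleCover

theorem re_eq (y : DoubleCover) : y.1.2.re ^ 2 - y.1.2.im ^ 2 = Sph.cubic (y.1.1.1 0) := by
  have h := congrArg Complex.re y.2
  rw [sq, Complex.mul_re] at h
  rw [sq, sq, h]
  rfl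

theorem im_eq (y : DoubleCover) : 2 * (y.1.2.re * y.1.2.im) = y.1.1.1 2 := by
  have h := congrArg Complex.im y.2
  rw [sq, Complex.mul_im] at h
  have h' : y.1.2.re * y.1.2.im + y.1.2.im * y.1.2.re = y.1.1.1 2 := h
  linarith

/-- A function on the sphere that is the integer `m 0`, `0`, `m 3` on the arcs `1`, `3`, `5` of the
equator. -/
noncomputable def oddExp (m : Fin 4 → ℤ) (p : Sph) : ℝ := bump (m 0) (m 3) (-p.1 0) (p.1 1)

/-- A function on the sphere that is the integer `0`, `m 1`, `m 2` on the arcs `0`, `2`, `4` of the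
equator. -/
noncomputable def evenExp (m : Fin 4 → ℤ) (p : Sph) : ℝ := bump (m 1) (m 2) (p.1 0) (p.1 1)

theorem continuous_oddExp (m : Fin 4 → ℤ) : Continuous (oddExp m) := by
  unfold oddExp bump; fun_prop

theorem continuous_evenExp (m : Fin 4 → ℤ) : Continuous (evenExp m) := by
  unfold evenExp bump; fun_prop

theorem sin_oddExp_eq_zero (m : Fin 4 → ℤ) {y : DoubleCover} (h : y.1.2.re = 0) :
    Real.sin (Real.pi * oddExp m y.1.1) = 0 := by
  have h1 := y.re_eq
  have h2 := y.im_eq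
  have h3 := y.1.1.sq_add
  rw [h] at h1 h2
  have h4 : 0 ≤ Sph.cubic (-y.1.1.1 0) := by
    have : Sph.cubic (-y.1.1.1 0) = -Sph.cubic (y.1.1.1 0) := by unfold Sph.cubic; ring
    rw [this, ← h1]
    nlinarith [sq_nonneg y.1.2.im]
  obtain ⟨n, hn⟩ := exists_int_bump (m 0) (m 3) (x := -y.1.1.1 0) (y := y.1.1.1 1)
    (by rw [← h2] at h3; linarith) h4
  rw [oddExp, hn, mul_comm]
  exact Real.sin_int_mul_pi n

theorem sin_evenExp_eq_zero (m : Fin 4 → ℤ) {y : DoubleCover} (h : y.1.2.im = 0) :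
    Real.sin (Real.pi * evenExp m y.1.1) = 0 := by
  have h1 := y.re_eq
  have h2 := y.im_eq
  have h3 := y.1.1.sq_add
  rw [h] at h1 h2
  obtain ⟨n, hn⟩ := exists_int_bump (m 1) (m 2) (x := y.1.1.1 0) (y := y.1.1.1 1)
    (by rw [← h2] at h3; linarith) (by rw [← h1]; nlinarith [sq_nonneg y.1.2.re])
  rw [evenExp, hn, mul_comm]
  exact Real.sin_int_mul_pi n

/-- A function from the double covering to the unit circle, inverted by the involution of the double
covering. Its class modulo seventh powers is determined by `m` modulo seven. -/
noncomputable def circleFn (m : Fin 4 → ℤ) (y : DoubleCover) : ℂ :=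
  phase y.1.2.re (oddExp m y.1.1) * phase y.1.2.im (evenExp m y.1.1)

theorem continuous_circleFn (m : Fin 4 → ℤ) : Continuous (circleFn m) := by
  refine (continuous_phase (by fun_prop) ((continuous_oddExp m).comp (by fun_prop)) fun y hy =>
    sin_oddExp_eq_zero m hy).mul (continuous_phase (by fun_prop)
    ((continuous_evenExp m).comp (by fun_prop)) fun y hy => sin_evenExp_eq_zero m hy)

theorem circleFn_ne_zero (m : Fin 4 → ℤ) (y : DoubleCover) : circleFn m y ≠ 0 := by
  have side : ∀ a : ℝ, ∃ s : ℝ, s ^ 2 = 1 ∧ 0 ≤ s * a := fun a => by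
    rcases le_total 0 a with h | h
    · exact ⟨1, by norm_num, by linarith⟩
    · exact ⟨-1, by norm_num, by linarith⟩
  obtain ⟨s, hs, ha⟩ := side y.1.2.re
  obtain ⟨t, ht, hb⟩ := side y.1.2.im
  rw [circleFn, phase_eq_exp hs ha fun h => sin_oddExp_eq_zero m h,
    phase_eq_exp ht hb fun h => sin_evenExp_eq_zero m h]
  exact mul_ne_zero (Complex.exp_ne_zero _) (Complex.exp_ne_zero _)

/-- The involution of the double covering. -/
def neg (y : DoubleCover) : DoubleCover := ⟨(y.1.1, -y.1.2), by rw [neg_sq, y.2]⟩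

theorem circleFn_neg (m : Fin 4 → ℤ) (y : DoubleCover) :
    circleFn m y.neg = conj (circleFn m y) := by
  simp only [circleFn, neg, Complex.neg_re, Complex.neg_im, phase_neg, map_mul]

theorem continuous_neg : Continuous neg := by
  unfold neg; fun_prop

end DoubleCover

open DoubleCover

/-- The unramified covering of degree seven of the double covering, given by the seventh roots of a
circle-valued function. -/
abbrev DihedralSpace (m : Fin 4 → ℤ) : Type := RootCover (circleFn m) 7

namespace DihedralSpace

variable {m : Fin 4 → ℤ}

instance : CompactSpace DoubleCover :=
  RootCover.compactSpace Sph.continuous_radicand two_ne_zero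

instance : CompactSpace (DihedralSpace m) :=
  RootCover.compactSpace (continuous_circleFn m) (by norm_num)

/-- The projection to the sphere. -/
def proj (z : DihedralSpace m) : Sph := z.1.1.1.1

/-- The square root of the radicand at a point. -/
def root (z : DihedralSpace m) : ℂ := z.1.1.1.2

theorem continuous_proj : Continuous (proj (m := m)) := by
  unfold proj; fun_prop

theorem root_sq (z : DihedralSpace m) : z.root ^ 2 = Sph.radicand z.proj := z.1.1.2

theorem snd_ne_zero (z : DihedralSpace m) : z.1.2 ≠ 0 := by
  intro h
  have := z.2
  rw [h, zero_pow (by norm_num)] at this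
  exact circleFn_ne_zero m _ this.symm

theorem ext {z z' : DihedralSpace m} (h1 : z.proj = z'.proj) (h2 : z.root = z'.root)
    (h3 : z.1.2 = z'.1.2) : z = z' :=
  Subtype.ext (Prod.ext (Subtype.ext (Prod.ext h1 h2)) h3)

/-- The rotations: multiplication of the seventh root by a root of unity. -/
noncomputable def rot (i : ZMod 7) (z : DihedralSpace m) : DihedralSpace m :=
  ⟨(z.1.1, ZMod.stdAddChar i * z.1.2), by rw [mul_pow, stdAddChar_pow_seven, one_mul, z.2]⟩

/-- A reflection, lifting the involution of the double covering. -/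
noncomputable def refl (z : DihedralSpace m) : DihedralSpace m :=
  ⟨(z.1.1.neg, conj z.1.2), by rw [← map_pow, z.2, circleFn_neg]⟩

theorem continuous_rot (i : ZMod 7) : Continuous (rot (m := m) i) := by
  unfold rot; fun_prop

theorem continuous_refl : Continuous (refl (m := m)) := by
  refine Continuous.subtype_mk
    (Continuous.prodMk (DoubleCover.continuous_neg.comp (by fun_prop)) ?_) _
  exact Complex.continuous_conj.comp (by fun_prop)

theorem rot_rot (i j : ZMod 7) (z : DihedralSpace m) : rot i (rot j z) = rot (i + j) z := by
  refine ext rfl rfl ?_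
  simp only [rot, AddChar.map_add_eq_mul, mul_assoc]

theorem rot_refl (i : ZMod 7) (z : DihedralSpace m) : rot i z.refl = (rot (-i) z).refl := by
  refine ext rfl rfl ?_
  simp only [rot, refl, map_mul, conj_stdAddChar, neg_neg]

theorem refl_refl (z : DihedralSpace m) : z.refl.refl = z := by
  refine ext rfl ?_ ?_
  · exact neg_neg _
  · exact Complex.conj_conj _

theorem rot_zero (z : DihedralSpace m) : rot 0 z = z := by
  refine ext rfl rfl ?_
  simp only [rot, AddChar.map_zero_eq_one, one_mul]

/-- The action of the dihedral group. -/
noncomputable instance : MulAction (DihedralGroup 7) (DihedralSpace m) where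
  smul g z := match g with
    | .r i => rot i z
    | .sr i => (rot i z).refl
  one_smul z := rot_zero z
  mul_smul g h z := by
    rcases g with i | i <;> rcases h with j | j
    · exact (rot_rot i j z).symm
    · change (rot (j - i) z).refl = rot i (rot j z).refl
      rw [rot_refl, rot_rot, neg_add_eq_sub]
    · change (rot (i + j) z).refl = (rot i (rot j z)).refl
      rw [rot_rot]
    · change rot (j - i) z = (rot i (rot j z).refl).refl
      rw [rot_refl, refl_refl, rot_rot, neg_add_eq_sub]

theorem sr_smul (i : ZMod 7) (z : DihedralSpace m) : DihedralGroup.sr i • z = (rot i z).refl := rfl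

instance : ContinuousConstSMul (DihedralGroup 7) (DihedralSpace m) where
  continuous_const_smul g := by
    rcases g with i | i
    · exact continuous_rot i
    · exact continuous_refl.comp (continuous_rot i)

theorem proj_smul (g : DihedralGroup 7) (z : DihedralSpace m) : (g • z).proj = z.proj := by
  rcases g with i | i <;> rfl

theorem rot_eq_self_iff {i : ZMod 7} {z : DihedralSpace m} : rot i z = z ↔ i = 0 := by
  constructor
  · intro h
    have h1 : ZMod.stdAddChar i * z.1.2 = z.1.2 := congrArg (fun z => z.1.2) h
    exact stdAddChar_eq_one_iff.1 (mul_eq_right₀ z.snd_ne_zero |>.1 h1)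
  · rintro rfl
    exact rot_zero z

/-- The action is free outside the vertices. -/
theorem eq_one_of_smul_eq {g : DihedralGroup 7} {z : DihedralSpace m} (hz : z.root ≠ 0)
    (h : g • z = z) : g = 1 := by
  rcases g with i | i
  · rw [rot_eq_self_iff.1 h]; rfl
  · have h1 : -z.root = z.root := congrArg root h
    exact absurd (neg_eq_self.1 h1) hz

theorem exists_rot_eq {z z' : DihedralSpace m} (h : z.proj = z'.proj) (hr : z.root = z'.root) :
    ∃ i, rot i z = z' := by
  have hy : z.1.1 = z'.1.1 := Subtype.ext (Prod.ext h hr)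
  have h1 : (z'.1.2 / z.1.2) ^ 7 = 1 := by
    rw [div_pow, z.2, z'.2, hy, div_self (circleFn_ne_zero m _)]
  obtain ⟨i, hi⟩ := exists_stdAddChar_eq h1
  refine ⟨i, ext h hr ?_⟩
  change ZMod.stdAddChar i * z.1.2 = _
  rw [hi, div_mul_cancel₀ _ z.snd_ne_zero]

/-- The fibres of the projection are the orbits. -/
theorem exists_smul_eq {z z' : DihedralSpace m} (h : z.proj = z'.proj) :
    ∃ g : DihedralGroup 7, g • z = z' := by
  have h1 : z.root ^ 2 = z'.root ^ 2 := by rw [root_sq, root_sq, h]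
  rcases sq_eq_sq_iff_eq_or_eq_neg.1 h1 with h2 | h2
  · obtain ⟨i, hi⟩ := exists_rot_eq h h2
    exact ⟨.r i, hi⟩
  · obtain ⟨i, hi⟩ := exists_rot_eq (z := z.refl) (z' := z') h
      (show -z.root = z'.root by rw [h2, neg_neg])
    refine ⟨.sr (-i), ?_⟩
    rw [sr_smul, ← rot_refl, hi]

/-! ### Ramification of the dihedral covering -/

theorem exists_localHomeomorph_doubleCover (z : DihedralSpace m) :
    ∃ e : OpenPartialHomeomorph (DihedralSpace m) DoubleCover, z ∈ e.source ∧ ∀ r, e r = r.1.1 :=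
  RootCover.exists_localHomeomorph (continuous_circleFn m) (by norm_num) z z.snd_ne_zero

theorem hasRamificationIndex_one {z : DihedralSpace m} (hz : z.root ≠ 0) :
    HasRamificationIndex (proj (m := m)) z 1 := by
  obtain ⟨e, he, hev⟩ := z.exists_localHomeomorph_doubleCover
  obtain ⟨e', he', hev'⟩ := RootCover.exists_localHomeomorph Sph.continuous_radicand two_ne_zero
    z.1.1 hz
  obtain ⟨ψ, hψ, hψ0⟩ := Sph.exists_chart z.proj
  have hcomp : ∀ y, e' (e y) = y.proj := fun y => by rw [hev, hev']; rfl
  refine ⟨le_rfl, (e.trans e').trans ψ, ψ, ?_, hψ, ?_, hψ0, ?_, ?_⟩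
  · simp only [OpenPartialHomeomorph.trans_source, mem_inter_iff, mem_preimage,
      OpenPartialHomeomorph.coe_trans, Function.comp_apply, hcomp]
    exact ⟨⟨he, by rw [hev]; exact he'⟩, hψ⟩
  · simp only [OpenPartialHomeomorph.coe_trans, Function.comp_apply, hcomp, hψ0]
  · intro y hy
    simp only [OpenPartialHomeomorph.trans_source, mem_inter_iff, mem_preimage,
      OpenPartialHomeomorph.coe_trans, Function.comp_apply, hcomp] at hy
    exact hy.2
  · intro y _
    simp only [OpenPartialHomeomorph.coe_trans, Function.comp_apply, hcomp, pow_one]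

theorem hasRamificationIndex_two {z : DihedralSpace m} (hz : z.root = 0) :
    HasRamificationIndex (proj (m := m)) z 2 := by
  have h0 : Sph.radicand z.proj = 0 := by rw [← root_sq, hz, zero_pow two_ne_zero]
  obtain ⟨e, he, hev⟩ := z.exists_localHomeomorph_doubleCover
  obtain ⟨ψ, hψ, hψP⟩ := Sph.exists_chart_radicand h0
  obtain ⟨e', he', hev', hsrc⟩ := RootCover.exists_localHomeomorph_root z.1.1 ψ hψ hψP
  have hcomp : ∀ y, e' (e y) = y.root := fun y => by rw [hev, hev']; rfl
  have hmap : MapsTo (proj (m := m)) (e.trans e').source ψ.source := by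
    intro y hy
    simp only [OpenPartialHomeomorph.trans_source, mem_inter_iff, mem_preimage, hev] at hy
    exact hsrc _ hy.2
  refine ⟨one_le_two, e.trans e', ψ, ?_, hψ, ?_, (hψP _ hψ).trans h0, hmap, ?_⟩
  · simp only [OpenPartialHomeomorph.trans_source, mem_inter_iff, mem_preimage, hev]
    exact ⟨he, he'⟩
  · simp only [OpenPartialHomeomorph.coe_trans, Function.comp_apply, hcomp, hz]
  · intro y hy
    simp only [OpenPartialHomeomorph.coe_trans, Function.comp_apply, hcomp, root_sq]
    exact hψP _ (hmap hy)

theorem hasBranchingScheme_of_root_ne_zero {z : DihedralSpace m} (hz : z.root ≠ 0) :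
    HasBranchingScheme (proj (m := m)) z.proj (Multiset.replicate 14 1) := by
  classical
  refine ⟨Finset.univ.image fun g : DihedralGroup 7 => g • z, fun _ => 1, ?_, ?_, ?_⟩
  · ext z'
    simp only [Finset.coe_image, Finset.coe_univ, image_univ, mem_range, mem_preimage,
      mem_singleton_iff]
    constructor
    · rintro ⟨g, rfl⟩
      exact proj_smul g z
    · intro h
      exact exists_smul_eq h.symm
  · intro z' hz'
    refine hasRamificationIndex_one fun h0 => hz ?_
    obtain ⟨g, -, rfl⟩ := Finset.mem_image.1 hz'
    have h1 := root_sq (g • z)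
    rw [h0, proj_smul, ← root_sq] at h1
    exact pow_eq_zero_iff two_ne_zero |>.1 (h1.symm.trans (zero_pow two_ne_zero))
  · rw [Multiset.map_const', Finset.card_val, Finset.card_image_of_injective, Finset.card_univ,
      ← Nat.card_eq_fintype_card, DihedralGroup.nat_card]
    intro g g' h
    have h1 : (g'⁻¹ * g) • z = z := by
      rw [mul_smul, inv_smul_eq_iff]; exact h
    exact (inv_mul_eq_one.1 (eq_one_of_smul_eq hz h1)).symm

theorem hasBranchingScheme_of_root_eq_zero {z : DihedralSpace m} (hz : z.root = 0) :
    HasBranchingScheme (proj (m := m)) z.proj (Multiset.replicate 7 2) := by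
  classical
  have hroot : ∀ z' : DihedralSpace m, z'.proj = z.proj → z'.root = 0 := fun z' h => by
    have h1 := root_sq z'
    rw [h, ← root_sq, hz, zero_pow two_ne_zero] at h1
    exact pow_eq_zero_iff two_ne_zero |>.1 h1
  refine ⟨Finset.univ.image fun i => rot i z, fun _ => 2, ?_, ?_, ?_⟩
  · ext z'
    simp only [Finset.coe_image, Finset.coe_univ, image_univ, mem_range, mem_preimage,
      mem_singleton_iff]
    constructor
    · rintro ⟨g, rfl⟩
      rfl
    · intro h
      exact exists_rot_eq h.symm (by rw [hz, hroot z' h])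
  · intro z' hz'
    obtain ⟨i, -, rfl⟩ := Finset.mem_image.1 hz'
    exact hasRamificationIndex_two hz
  · rw [Multiset.map_const', Finset.card_val, Finset.card_image_of_injective, Finset.card_univ,
      ZMod.card]
    intro i j h
    have h1 : rot (-j + i) z = z := by
      rw [← rot_rot, show rot i z = rot j z from h, rot_rot, neg_add_cancel, rot_zero]
    exact (neg_add_eq_zero.1 (rot_eq_self_iff.1 h1)).symm

end DihedralSpace

/-! ### Sections over the two hemispheres -/

namespace Sph

/-- The square root of the radicand on a closed hemisphere, with nonnegative real part. -/
noncomputable def hemiRoot (ε : Bool) (w : Disc) : ℂ :=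
  ⟨√((‖radicand (discDouble.hemi ε w)‖ + (radicand (discDouble.hemi ε w)).re) / 2),
    side ε * √((‖radicand (discDouble.hemi ε w)‖ - (radicand (discDouble.hemi ε w)).re) / 2)⟩

theorem hemiRoot_sq (ε : Bool) (w : Disc) :
    hemiRoot ε w ^ 2 = radicand (discDouble.hemi ε w) := by
  set P := radicand (discDouble.hemi ε w) with hP
  have h1 : 0 ≤ (‖P‖ + P.re) / 2 := by linarith [neg_abs_le P.re, Complex.abs_re_le_norm P]
  have h2 : 0 ≤ (‖P‖ - P.re) / 2 := by linarith [le_abs_self P.re, Complex.abs_re_le_norm P]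
  have hside : side ε * |P.im| = P.im := by
    have : P.im = side ε * √(1 - ((w : ℂ).re ^ 2 + (w : ℂ).im ^ 2)) := rfl
    rw [this, abs_mul, abs_of_nonneg (Real.sqrt_nonneg _)]
    cases ε <;> simp [side]
  have h3 : √((‖P‖ + P.re) / 2) * √((‖P‖ - P.re) / 2) = |P.im| / 2 := by
    rw [← Real.sqrt_mul h1, ← Real.sqrt_sq (show 0 ≤ |P.im| / 2 by positivity)]
    congr 1
    have := Complex.sq_norm P
    rw [Complex.normSq_apply] at this
    rw [div_pow, sq_abs]
    linarith
  rw [sq]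
  apply Complex.ext
  · rw [Complex.mul_re]
    change √((‖P‖ + P.re) / 2) * √((‖P‖ + P.re) / 2) -
      side ε * √((‖P‖ - P.re) / 2) * (side ε * √((‖P‖ - P.re) / 2)) = _
    rw [mul_mul_mul_comm, Real.mul_self_sqrt h1, Real.mul_self_sqrt h2, ← sq, side_sq]
    ring
  · rw [Complex.mul_im]
    change √((‖P‖ + P.re) / 2) * (side ε * √((‖P‖ - P.re) / 2)) +
      side ε * √((‖P‖ - P.re) / 2) * √((‖P‖ + P.re) / 2) = _
    linear_combination 2 * side ε * h3 + hside

theorem continuous_hemiRoot (ε : Bool) : Continuous (hemiRoot ε) := by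
  have key : ∀ P : Disc → ℂ, Continuous P → Continuous fun w =>
      (⟨√((‖P w‖ + (P w).re) / 2), side ε * √((‖P w‖ - (P w).re) / 2)⟩ : ℂ) := fun P hP =>
    Complex.equivRealProdCLM.symm.continuous.comp
      ((by fun_prop : Continuous fun w => √((‖P w‖ + (P w).re) / 2)).prodMk
        (by fun_prop : Continuous fun w => side ε * √((‖P w‖ - (P w).re) / 2)))
  exact key _ (continuous_radicand.comp (discDouble.continuous_hemi ε))

theorem hemi_false_eq {w : Disc} (hw : ‖(w : ℂ)‖ = 1) :
    discDouble.hemi false w = discDouble.hemi true w :=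
  (discDouble.hemi_eq_iff _ _ _ _).2 ⟨rfl, Or.inr hw⟩

theorem radicand_hemi {ε : Bool} {w : Disc} (hw : ‖(w : ℂ)‖ = 1) :
    radicand (discDouble.hemi ε w) = (cubic (w : ℂ).re : ℝ) := by
  apply Complex.ext
  · rfl
  · change side ε * √(1 - ((w : ℂ).re ^ 2 + (w : ℂ).im ^ 2)) = 0
    rw [norm_eq_one_iff_sq.1 hw]; simp

/-- On the boundary circle the two square roots agree where the radicand is nonnegative. -/
theorem hemiRoot_false_of_nonneg {w : Disc} (hw : ‖(w : ℂ)‖ = 1) (h : 0 ≤ cubic (w : ℂ).re) :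
    hemiRoot false w = hemiRoot true w := by
  apply Complex.ext
  · simp only [hemiRoot, radicand_hemi hw]
  · simp only [hemiRoot, radicand_hemi hw, Complex.norm_real, Real.norm_eq_abs, abs_of_nonneg h,
      Complex.ofReal_re, sub_self, zero_div, Real.sqrt_zero, mul_zero]

theorem hemiRoot_false_of_nonpos {w : Disc} (hw : ‖(w : ℂ)‖ = 1) (h : cubic (w : ℂ).re ≤ 0) :
    hemiRoot false w = -hemiRoot true w := by
  apply Complex.ext
  · simp only [hemiRoot, radicand_hemi hw, Complex.norm_real, Real.norm_eq_abs, abs_of_nonpos h,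
      Complex.ofReal_re, neg_add_cancel, zero_div, Real.sqrt_zero, Complex.neg_re, neg_zero]
  · simp [hemiRoot, radicand_hemi hw, side]

theorem cubic_nonneg {x : ℝ} :
    (1 / 2 ≤ x → 0 ≤ cubic x) ∧ (-(1 / 2) ≤ x → x ≤ 0 → 0 ≤ cubic x) := by
  have e : cubic x = x * ((2 * x - 1) * (2 * x + 1)) := by unfold cubic; ring
  rw [e]
  refine ⟨fun h => ?_, fun h h' => ?_⟩
  · exact mul_nonneg (by linarith) (mul_nonneg (by linarith) (by linarith))
  · exact mul_nonneg_of_nonpos_of_nonpos h'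
      (mul_nonpos_of_nonpos_of_nonneg (by linarith) (by linarith))

end Sph

namespace DihedralSpace

open Sph DoubleCover

variable {m : Fin 4 → ℤ}

/-- The argument of the seventh root that is chosen in the section over a hemisphere. -/
noncomputable def secArg (m : Fin 4 → ℤ) (ε : Bool) (p : Sph) : ℝ :=
  -(Real.pi / 7 * (oddExp m p + side ε * evenExp m p))

/-- A section over a closed hemisphere. -/
noncomputable def sec (ε : Bool) (w : Disc) : DihedralSpace m :=
  ⟨(⟨(discDouble.hemi ε w, hemiRoot ε w), hemiRoot_sq ε w⟩,
    Complex.exp (secArg m ε (discDouble.hemi ε w) * Complex.I)), by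
    have h1 : (0 : ℝ) ≤ 1 * (hemiRoot ε w).re := by
      rw [one_mul]; exact Real.sqrt_nonneg _
    have h2 : 0 ≤ side ε * (hemiRoot ε w).im := by
      change 0 ≤ side ε * (side ε * √_)
      rw [← mul_assoc, ← sq, side_sq, one_mul]
      exact Real.sqrt_nonneg _
    change _ = phase (hemiRoot ε w).re _ * phase (hemiRoot ε w).im _
    rw [phase_eq_exp (one_pow 2) h1 fun h => sin_oddExp_eq_zero m h,
      phase_eq_exp (side_sq ε) h2 fun h => sin_evenExp_eq_zero m h, ← Complex.exp_nat_mul,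
      ← Complex.exp_add]
    congr 1
    simp only [secArg]
    push_cast
    ring⟩

theorem continuous_sec (ε : Bool) : Continuous (sec (m := m) ε) := by
  have h := discDouble.continuous_hemi ε
  have h1 := (continuous_oddExp m).comp h
  have h2 := (continuous_evenExp m).comp h
  refine Continuous.subtype_mk (Continuous.prodMk (Continuous.subtype_mk
    (h.prodMk (continuous_hemiRoot ε)) _) ?_) _
  simp only [secArg]
  simp only [Function.comp_def] at h1 h2
  fun_prop

theorem stdAddChar_intCast (n : ℤ) : ZMod.stdAddChar (n : ZMod 7) =
    Complex.exp ((2 * Real.pi / 7 * n : ℝ) * Complex.I) := by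
  rw [ZMod.stdAddChar_coe]
  congr 1
  push_cast
  ring

theorem sec_false_of_nonneg {w : Disc} (hw : ‖(w : ℂ)‖ = 1) (h : 0 ≤ cubic (w : ℂ).re) {n : ℤ}
    (hn : evenExp m (discDouble.hemi true w) = n) :
    sec (m := m) false w = DihedralGroup.r (n : ZMod 7) • sec true w := by
  refine ext (hemi_false_eq hw) (hemiRoot_false_of_nonneg hw h) ?_
  change Complex.exp _ = ZMod.stdAddChar (n : ZMod 7) * Complex.exp _
  rw [stdAddChar_intCast, ← Complex.exp_add, ← add_mul, ← Complex.ofReal_add,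
    hemi_false_eq hw, secArg, secArg, hn, side, side, cond_true, cond_false]
  congr 3
  ring

theorem sec_false_of_nonpos {w : Disc} (hw : ‖(w : ℂ)‖ = 1) (h : cubic (w : ℂ).re ≤ 0) {n : ℤ}
    (hn : oddExp m (discDouble.hemi true w) = n) :
    sec (m := m) false w = DihedralGroup.sr (n : ZMod 7) • sec true w := by
  refine ext (hemi_false_eq hw) (hemiRoot_false_of_nonpos hw h) ?_
  change Complex.exp _ = conj (ZMod.stdAddChar (n : ZMod 7) * Complex.exp _)
  rw [stdAddChar_intCast, ← Complex.exp_add, ← Complex.exp_conj, ← add_mul, ← Complex.ofReal_add,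
    map_mul, Complex.conj_ofReal, Complex.conj_I, mul_neg, ← neg_mul, ← Complex.ofReal_neg,
    hemi_false_eq hw, secArg, secArg, hn, side, side, cond_true, cond_false]
  congr 3
  ring

/-- The sections over the two hemispheres differ on the arcs by the gluing elements. -/
theorem sec_false_eq (k : Fin 6) {w : Disc} (hw : (w : ℂ) ∈ arc k) :
    sec (m := m) false w = gluing (fun j => (m j : ZMod 7)) k • sec true w := by
  have h1 := norm_eq_one_of_mem_arc hw
  have h2 := norm_eq_one_iff_sq.1 h1
  have h2' : (-(w : ℂ).re) ^ 2 + (w : ℂ).im ^ 2 = 1 := by rw [neg_sq]; exact h2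
  have hodd : cubic (-(w : ℂ).re) = -cubic (w : ℂ).re := by unfold cubic; ring
  have hp := cubic_nonneg (x := (w : ℂ).re)
  have hq := cubic_nonneg (x := -(w : ℂ).re)
  rw [hodd] at hq
  have hr := sec_false_of_nonneg (m := m) h1
  have hs := sec_false_of_nonpos (m := m) h1
  have he : evenExp m (discDouble.hemi true w) = bump (m 1) (m 2) (w : ℂ).re (w : ℂ).im := rfl
  have ho : oddExp m (discDouble.hemi true w) = bump (m 0) (m 3) (-(w : ℂ).re) (w : ℂ).im := rfl
  rw [he] at hr
  rw [ho] at hs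
  fin_cases k
  · have := hr (hp.1 hw.2) (n := 0) (by rw [bump_right hw.2, Int.cast_zero])
    rwa [Int.cast_zero] at this
  · obtain ⟨-, ⟨h3, h4⟩, h5⟩ := hw
    exact hs (by linarith [hq.2 (by linarith) (by linarith)])
      (bump_upper h2' (by linarith) (by linarith) h5)
  · obtain ⟨-, ⟨h3, h4⟩, h5⟩ := hw
    exact hr (hp.2 h3 h4) (bump_upper h2 h3 h4 h5)
  · obtain ⟨-, h3⟩ := hw
    have := hs (by linarith [hq.1 (by linarith)]) (n := 0)
      (by rw [bump_right (by linarith), Int.cast_zero])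
    rwa [Int.cast_zero] at this
  · obtain ⟨-, ⟨h3, h4⟩, h5⟩ := hw
    exact hr (hp.2 h3 h4) (bump_lower h2 h3 h4 h5)
  · obtain ⟨-, ⟨h3, h4⟩, h5⟩ := hw
    exact hs (by linarith [hq.2 (by linarith) (by linarith)])
      (bump_lower h2' (by linarith) (by linarith) h5)

theorem exists_smul_sec_eq (z : DihedralSpace m) :
    ∃ (g : DihedralGroup 7) (ε : Bool) (w : Disc), g • sec ε w = z := by
  obtain ⟨ε, w, h⟩ := discDouble.exists_hemi z.proj
  obtain ⟨g, hg⟩ := exists_smul_eq (z := sec ε w) (z' := z) h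
  exact ⟨g, ε, w, hg⟩

end DihedralSpace

/-! ### Connectedness of the dihedral covering -/

/-- For `v ≠ 0` the gluing elements generate the dihedral group. -/
theorem forall_mem_of_gluing_mul_mem {v : Fin 4 → ZMod 7} (hv : v ≠ 0)
    {S : Set (DihedralGroup 7)} (h1 : 1 ∈ S) (hS : ∀ g ∈ S, ∀ k, g * gluing v k ∈ S)
    (g : DihedralGroup 7) : g ∈ S := by
  have hr : ∀ j, ∀ g ∈ S, g * .r (v j) ∈ S := by
    intro j g hg
    fin_cases j
    · have := hS _ (hS g hg 3) 1
      rwa [mul_assoc, show gluing v 3 * gluing v 1 = .r (v 0 - 0) from rfl, sub_zero] at this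
    · exact hS g hg 2
    · exact hS g hg 4
    · have := hS _ (hS g hg 3) 5
      rwa [mul_assoc, show gluing v 3 * gluing v 5 = .r (v 3 - 0) from rfl, sub_zero] at this
  obtain ⟨j, hj⟩ := Function.ne_iff.1 hv
  have hj' : v j ≠ 0 := hj
  have hpow : ∀ n : ℕ, ∀ g ∈ S, g * .r (n * v j) ∈ S := by
    intro n
    induction n with
    | zero => intro g hg; simpa using hg
    | succ n ih =>
      intro g hg
      have := hr j _ (ih g hg)
      rwa [mul_assoc, DihedralGroup.r_mul_r, show (n : ZMod 7) * v j + v j = (n + 1 : ℕ) * v j by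
        push_cast; ring] at this
  have hall : ∀ i : ZMod 7, .r i ∈ S := by
    intro i
    have := hpow (i / v j).val 1 h1
    rwa [ZMod.natCast_zmod_val, div_mul_cancel₀ _ hj', one_mul] at this
  rcases g with i | i
  · exact hall i
  · have := hS _ (hall (-i)) 3
    rwa [show DihedralGroup.r (-i) * gluing v 3 = .sr (0 - -i) from rfl, zero_sub, neg_neg] at this

namespace DihedralSpace

variable {m : Fin 4 → ℤ}

theorem connectedSpace (hm : (fun j => (m j : ZMod 7)) ≠ 0) : ConnectedSpace (DihedralSpace m) := by
  have : PreconnectedSpace Disc :=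
    isPreconnected_iff_preconnectedSpace.1 (convex_closedBall (0 : ℂ) 1).isPreconnected
  have hconn : ∀ (g : DihedralGroup 7) (ε : Bool) (w w' : Disc),
      g • sec (m := m) ε w' ∈ connectedComponent (g • sec (m := m) ε w) := by
    intro g ε w w'
    have h := isPreconnected_univ.image (fun w => g • sec (m := m) ε w)
      ((continuous_sec ε).const_smul g).continuousOn
    exact h.subset_connectedComponent (mem_image_of_mem _ (mem_univ w))
      (mem_image_of_mem _ (mem_univ w'))
  set z₀ : DihedralSpace m := sec true discZero
  have hS := forall_mem_of_gluing_mul_mem hm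
    (S := {g | g • z₀ ∈ connectedComponent z₀})
    (by rw [mem_ofPred_eq, one_smul]; exact mem_connectedComponent) ?_
  · have hfalse : ∀ (g : DihedralGroup 7) (w : Disc),
        g • sec (m := m) false w ∈ connectedComponent z₀ := by
      intro g w
      have h1 := hconn g true discZero (vertexPt 0)
      have h2 := hconn g false (vertexPt 0) w
      rw [sec_false_eq 0 (vertexPt_mem_arc 0).1, show gluing _ 0 = 1 from rfl, one_smul,
        ← connectedComponent_eq h1, ← connectedComponent_eq (hS g)] at h2
      exact h2
    have huniv : connectedComponent z₀ = univ := by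
      refine eq_univ_of_forall fun z => ?_
      obtain ⟨g, ε, w, rfl⟩ := exists_smul_sec_eq z
      cases ε
      · exact hfalse g w
      · rw [connectedComponent_eq (hS g)]
        exact hconn g true discZero w
    exact connectedSpace_iff_connectedComponent.2 ⟨z₀, huniv⟩
  · -- pass to the lower hemisphere through the arc `0`, and back through the arc `k`
    intro g hg k
    have h1 := hconn g true discZero (vertexPt 0)
    have h2 := hconn g false (vertexPt 0) (vertexPt k)
    have h3 := hconn (g * gluing (fun j => (m j : ZMod 7)) k) true (vertexPt k) discZero
    rw [sec_false_eq k (vertexPt_mem_arc k).1, smul_smul, sec_false_eq 0 (vertexPt_mem_arc 0).1,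
      show gluing _ 0 = 1 from rfl, one_smul] at h2
    rw [mem_ofPred_eq, connectedComponent_eq hg, connectedComponent_eq h1, connectedComponent_eq h2]
    exact h3

end DihedralSpace

/-! ### The coverings of the Riemann sphere -/

/-- Transport of a presentation as a double of the disc along a homeomorphism. -/
def DiscDouble.map {X Y : Type*} [TopologicalSpace X] [TopologicalSpace Y] (D : DiscDouble X)
    (H : X ≃ₜ Y) : DiscDouble Y where
  hemi ε w := H (D.hemi ε w)
  continuous_hemi ε := H.continuous.comp (D.continuous_hemi ε)
  hemi_eq_iff ε ε' w w' := by rw [H.injective.eq_iff, D.hemi_eq_iff]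
  exists_hemi x := by
    obtain ⟨ε, w, h⟩ := D.exists_hemi (H.symm x)
    exact ⟨ε, w, by rw [h, H.apply_symm_apply]⟩

theorem HasBranchingScheme.homeomorph_comp {Z W X : Type*} [TopologicalSpace Z]
    [TopologicalSpace W] [TopologicalSpace X] {f : Z → W} {x : W} {s : Multiset ℕ}
    (h : HasBranchingScheme f x s) (H : W ≃ₜ X) :
    HasBranchingScheme (fun y => H (f y)) (H x) s := by
  obtain ⟨t, e, ht, he, hs⟩ := h
  refine ⟨t, e, ?_, fun z hz => (he z hz).homeomorph_comp H, hs⟩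
  rw [ht]
  ext z
  simp [H.injective.eq_iff]

namespace DihedralSpace

variable {m : Fin 4 → ℤ}

/-- The branched covering of the Riemann sphere given by the space `DihedralSpace m` and an
identification of the round sphere with the Riemann sphere. -/
noncomputable def covering (hm : (fun j => (m j : ZMod 7)) ≠ 0) (H : Sph ≃ₜ OnePoint ℂ) :
    SphereCovering :=
  have := connectedSpace hm
  { Z := DihedralSpace m
    f := fun z => H z.proj
    continuous_f := H.continuous.comp continuous_proj
    locally_power := fun z => by
      by_cases hz : z.root = 0
      · exact ⟨2, (hasRamificationIndex_two hz).homeomorph_comp H⟩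
      · exact ⟨1, (hasRamificationIndex_one hz).homeomorph_comp H⟩ }

theorem exists_cutting {B : Finset (OnePoint ℂ)} {H : Sph ≃ₜ OnePoint ℂ}
    (hB : (Sph.discDouble.map H).IsBranchedAt B) (hm : (fun j => (m j : ZMod 7)) ≠ 0) :
    ∃ C : DihedralCovering B,
      Nonempty (Cutting (Sph.discDouble.map H) C.1 (gluing fun j => (m j : ZMod 7))) := by
  set C := covering hm H with hC
  have hmem : ∀ z : DihedralSpace m, H z.proj ∈ B ↔ z.root = 0 := by
    intro z
    obtain ⟨ε, w, hw⟩ := Sph.discDouble.exists_hemi z.proj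
    rw [← pow_eq_zero_iff two_ne_zero, root_sq, ← hw, Sph.radicand_eq_zero_iff]
    exact hB.hemi_mem
  have hU : C.IsUnramifiedOutside (B : Set (OnePoint ℂ)) := fun z hz =>
    (hasRamificationIndex_one fun h => hz ((hmem z).2 h)).homeomorph_comp H
  have hsurj : ∀ x, ∃ z : DihedralSpace m, H z.proj = x := by
    intro x
    obtain ⟨ε, w, hw⟩ := (Sph.discDouble.map H).exists_hemi x
    exact ⟨sec ε w, hw⟩
  have hscheme : ∀ b ∈ B, HasBranchingScheme C.f b (Multiset.replicate 7 2) := by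
    intro b hb
    obtain ⟨z, rfl⟩ := hsurj b
    exact (hasBranchingScheme_of_root_eq_zero ((hmem z).1 hb)).homeomorph_comp H
  have hdeg : C.HasDegree 14 := by
    intro x
    by_cases hx : x ∈ B
    · exact ⟨_, hscheme x hx, by simp⟩
    · obtain ⟨z, rfl⟩ := hsurj x
      exact ⟨_, (hasBranchingScheme_of_root_ne_zero fun h => hx ((hmem z).2 h)).homeomorph_comp H,
        by simp⟩
  let act : DihedralGroup 7 →* (C.Z ≃ₜ C.Z) :=
    { toFun := fun g => (Homeomorph.smul g : DihedralSpace m ≃ₜ DihedralSpace m)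
      map_one' := Homeomorph.ext fun z : DihedralSpace m => one_smul (DihedralGroup 7) z
      map_mul' := fun g h => Homeomorph.ext fun z : DihedralSpace m => mul_smul g h z }
  set z₀ : DihedralSpace m := sec true discZero with hz₀
  have hz₀B : H z₀.proj ∉ B := hemi_discZero_notMem hB true
  have hinj : Function.Injective act := by
    rw [injective_iff_map_eq_one]
    intro g hg
    refine eq_one_of_smul_eq (z := z₀) (fun h => hz₀B ((hmem z₀).2 h)) ?_
    exact congrArg (fun h : C.Z ≃ₜ C.Z => h z₀) hg
  have hact : ∀ g, act g ∈ C.deckGroup := fun g (z : DihedralSpace m) =>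
    congrArg H (proj_smul g z)
  have hrange : act.range = C.deckGroup := by
    apply le_antisymm
    · rintro _ ⟨g, rfl⟩
      exact hact g
    · intro h hh
      have h1 : (h z₀ : DihedralSpace m).proj = z₀.proj := H.injective (hh z₀)
      obtain ⟨g, hg⟩ := exists_smul_eq h1.symm
      have h2 : (act g)⁻¹ * h = 1 := by
        refine SphereCovering.deck_eq_one hU (mul_mem (inv_mem (hact g)) hh) (z := z₀) hz₀B ?_
        exact (act g).symm_apply_eq.2 hg.symm
      exact ⟨g, inv_mul_eq_one.1 h2⟩
  refine ⟨⟨C, ⟨⟨(MulEquiv.subgroupCongr hrange).symm.trans (MonoidHom.ofInjective hinj).symm⟩, ?_⟩,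
    hU, hscheme⟩, ⟨⟨act, hinj, hrange, sec, continuous_sec, fun _ _ => rfl,
      fun k w hw => sec_false_eq k hw⟩⟩⟩
  rw [DihedralGroup.nat_card]
  exact hdeg

end DihedralSpace

/-- Any six points of the Riemann sphere are the six vertices in a presentation of the sphere as the
double of the disc. -/
theorem exists_homeomorph_isBranchedAt {B : Finset (OnePoint ℂ)} (hB : B.card = 6) :
    ∃ H : Sph ≃ₜ OnePoint ℂ, (Sph.discDouble.map H).IsBranchedAt B := by
  have hinj : Function.Injective fun k : Fin 6 => Sph.discDouble.hemi true (vertexPt k) := by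
    intro k l h
    exact vertex_injective (congrArg Subtype.val ((Sph.discDouble.hemi_eq_iff _ _ _ _).1 h).1)
  let e := (B.equivFinOfCardEq hB).symm
  obtain ⟨H, hH⟩ := Sph.exists_homeomorph hinj (b := fun k => (e k : OnePoint ℂ))
    (Subtype.val_injective.comp e.injective)
  refine ⟨H, fun x => ⟨fun hx => ⟨e.symm ⟨x, hx⟩, ?_⟩, ?_⟩⟩
  · exact (hH _).trans (by rw [e.apply_symm_apply])
  · rintro ⟨k, rfl⟩
    have h := (e k).2
    rw [← hH k] at h
    exact h

theorem propositionP (B : Finset (OnePoint ℂ)) (hB : B.card = 6) :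
    Nonempty (Quotient (dihedralCoveringSetoid B) ≃ ℙ (ZMod 7) (Fin 4 → ZMod 7)) := by
  obtain ⟨H, hH⟩ := exists_homeomorph_isBranchedAt hB
  refine nonempty_equiv_projectivization hH fun v hv => ?_
  have hv' : (fun j => (((v j).val : ℤ) : ZMod 7)) = v := by
    funext j; simp
  have h := DihedralSpace.exists_cutting hH (m := fun j => ((v j).val : ℤ)) (by rwa [hv'])
  rwa [hv'] at h
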